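/- Let $k$ be an algebraically closed field of characteristic zero. For $n\ge 1$ let $\mathcal A_s(n)$ be the Hopf algebra over $k$ generated as an algebra by $u_{ij}$ ($1\le i,j\le n$) with relations $u_{ij}u_{il}=\delta_{jl}u_{ij}$, $u_{ij}u_{lj}=\delta_{il}u_{ij}$, $\sum_{l}u_{il}=1=\sum_{l}u_{li}$, and with $\Delta(u_{ij})=\sum_{l}u_{il}\otimes u_{lj}$, $\varepsilon(u_{ij})=\delta_{ij}$, $S(u_{ij})=u_{ji}$. A *quantum permutation algebra* is a Hopf algebra over $k$ that is a quotient Hopf algebra of $\mathcal A_s(n)$ for some $n\ge 1$; the smallest such $n$ is its *degree* $d(H)$. For a finite-dimensional Hopf algebra $H$ over $k$, let $H^*$ be the dual Hopf algebra, and let $D(H)$ be the Drinfeld double: the Hopf algebra that is $H^{*\mathrm{cop}}\otimes H$ as a coalgebra, with multiplication $(f\otimes h)(f'\otimes h')=\sum f\,(h_1\rightharpoonup f'\leftharpoonup S^{-1}(h_3))\otimes h_2h'$, where $(a\rightharpoonup f\leftharpoonup b)(x)=f(bxa)$. 1. Let $H$ be a finite-dimensional Hopf algebra over $k$. If $H$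 and $H^*$ are quantum permutation algebras (in particular they are then cosemisimple), then $D(H)$ is a quantum permutation algebra, and $d(D(H))\le d(H)+d(H^*)$. 2. For every finite group $G$, the Drinfeld double $D(G)=D(kG)$ of the group algebra $kG$ is a quantum permutation algebra, of degree at most $|G|(1+|G|)$. -/

import Mathlib

noncomputable section

namespace QuantumPermutation

open TensorProduct Coalgebra HopfAlgebra

universe u v w

/-! ### The algebra of the quantum permutation group on `n` points -/

section Magic

variable (k : Type u) [Field k] (n : ℕ)

/-- The defining relations of `𝒜_s(n)`: the matrix `(u i j)` of generators is magic. -/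
inductive MagicRel : FreeAlgebra k (Fin n × Fin n) → FreeAlgebra k (Fin n × Fin n) → Prop
  | row_mul (i j l : Fin n) :
      MagicRel (FreeAlgebra.ι k (i, j) * FreeAlgebra.ι k (i, l))
        (if j = l then FreeAlgebra.ι k (i, j) else 0)
  | col_mul (i j l : Fin n) :
      MagicRel (FreeAlgebra.ι k (i, j) * FreeAlgebra.ι k (l, j))
        (if i = l then FreeAlgebra.ι k (i, j) else 0)
  | row_sum (i : Fin n) : MagicRel (∑ l, FreeAlgebra.ι k (i, l)) 1
  | col_sum (i : Fin n) : MagicRel (∑ l, FreeAlgebra.ι k (l, i)) 1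

/-- `𝒜_s(n)`: the `k`-algebra presented by generators `u i j`, `1 ≤ i, j ≤ n`, subject to the
relations that make `(u i j)` a magic matrix. -/
def MagicAlgebra : Type u := RingQuot (MagicRel k n)

instance : Ring (MagicAlgebra k n) := inferInstanceAs (Ring (RingQuot (MagicRel k n)))

instance : Algebra k (MagicAlgebra k n) :=
  inferInstanceAs (Algebra k (RingQuot (MagicRel k n)))

/-- A square matrix with entries in a ring is magic if its rows and its columns are partitions of
unity by orthogonal idempotents. -/
structure IsMagic {n : ℕ} {A : Type*} [Ring A] (x : Fin n → Fin n → A) : Prop where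
  row_mul (i j l : Fin n) : x i j * x i l = if j = l then x i j else 0
  col_mul (i j l : Fin n) : x i j * x l j = if i = l then x i j else 0
  row_sum (i : Fin n) : ∑ l, x i l = 1
  col_sum (i : Fin n) : ∑ l, x l i = 1

namespace MagicAlgebra

variable {n}

/-- The generator `u i j` of `𝒜_s(n)`. -/
def gen (i j : Fin n) : MagicAlgebra k n :=
  RingQuot.mkAlgHom k (MagicRel k n) (FreeAlgebra.ι k (i, j))

lemma isMagic_gen : IsMagic (gen k (n := n)) where
  row_mul i j l := by
    have := RingQuot.mkAlgHom_rel k (MagicRel.row_mul (k := k) i j l)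
    rw [map_mul, apply_ite (RingQuot.mkAlgHom k (MagicRel k n)), map_zero] at this
    exact this
  col_mul i j l := by
    have := RingQuot.mkAlgHom_rel k (MagicRel.col_mul (k := k) i j l)
    rw [map_mul, apply_ite (RingQuot.mkAlgHom k (MagicRel k n)), map_zero] at this
    exact this
  row_sum i := by
    have := RingQuot.mkAlgHom_rel k (MagicRel.row_sum (k := k) i)
    rw [map_sum, map_one] at this
    exact this
  col_sum i := by
    have := RingQuot.mkAlgHom_rel k (MagicRel.col_sum (k := k) i)
    rw [map_sum, map_one] at this
    exact this

variable {k}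

/-- The universal property of `𝒜_s(n)`. -/
def lift {A : Type*} [Ring A] [Algebra k A] (x : Fin n → Fin n → A) (hx : IsMagic x) :
    MagicAlgebra k n →ₐ[k] A :=
  RingQuot.liftAlgHom k ⟨FreeAlgebra.lift k fun p : Fin n × Fin n => x p.1 p.2, by
    intro a b h
    induction h with
    | row_mul i j l =>
      simp only [map_mul, FreeAlgebra.lift_ι_apply, hx.row_mul]
      split_ifs <;> simp
    | col_mul i j l =>
      simp only [map_mul, FreeAlgebra.lift_ι_apply, hx.col_mul]
      split_ifs <;> simp
    | row_sum i => simp [hx.row_sum]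
    | col_sum i => simp [hx.col_sum]⟩

@[simp]
lemma lift_gen {A : Type*} [Ring A] [Algebra k A] (x : Fin n → Fin n → A) (hx : IsMagic x)
    (i j : Fin n) : lift (k := k) x hx (gen k i j) = x i j := by
  unfold lift gen
  erw [RingQuot.liftAlgHom_mkAlgHom_apply]
  simp

lemma algHom_ext {A : Type*} [Ring A] [Algebra k A] {f g : MagicAlgebra k n →ₐ[k] A}
    (h : ∀ i j, f (gen k i j) = g (gen k i j)) : f = g := by
  refine RingQuot.ringQuot_ext' (S := k) (s := MagicRel k n) f g ?_
  ext ⟨i, j⟩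
  exact h i j

lemma adjoin_gen :
    Algebra.adjoin k (Set.range fun p : Fin n × Fin n => gen k p.1 p.2) = ⊤ := by
  set S := Algebra.adjoin k (Set.range fun p : Fin n × Fin n => gen k p.1 p.2) with hS
  have hg : ∀ i j, gen k i j ∈ S := fun i j => Algebra.subset_adjoin ⟨(i, j), rfl⟩
  have hm : IsMagic (fun i j => (⟨gen k i j, hg i j⟩ : S)) := by
    constructor
    · intro i j l
      apply Subtype.ext
      have := (isMagic_gen k).row_mul i j l
      split_ifs with h <;> simp_all
    · intro i j l
      apply Subtype.ext
      have := (isMagic_gen k).col_mul i j l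
      split_ifs with h <;> simp_all
    · intro i
      apply Subtype.ext
      simpa using (isMagic_gen k).row_sum i
    · intro i
      apply Subtype.ext
      simpa using (isMagic_gen k).col_sum i
  have : S.val.comp (lift (k := k) _ hm) = AlgHom.id k _ := algHom_ext fun i j => by simp
  rw [eq_top_iff]
  intro x _
  rw [show x = S.val (lift (k := k) _ hm x) from (DFunLike.congr_fun this x).symm]
  exact (lift (k := k) _ hm x).2

@[elab_as_elim]
lemma induction {P : MagicAlgebra k n → Prop} (hgen : ∀ i j, P (gen k i j))
    (hscalar : ∀ r, P (algebraMap k _ r)) (hadd : ∀ x y, P x → P y → P (x + y))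
    (hmul : ∀ x y, P x → P y → P (x * y)) (x : MagicAlgebra k n) : P x := by
  have hx : x ∈ Algebra.adjoin k (Set.range fun p : Fin n × Fin n => gen k p.1 p.2) := by
    rw [adjoin_gen]; trivial
  induction hx using Algebra.adjoin_induction with
  | mem x hx => obtain ⟨p, rfl⟩ := hx; exact hgen _ _
  | algebraMap r => exact hscalar r
  | add x y _ _ hx hy => exact hadd x y hx hy
  | mul x y _ _ hx hy => exact hmul x y hx hy

lemma isMagic_comul :
    IsMagic fun i j : Fin n => ∑ l, gen k i l ⊗ₜ[k] gen k l j where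
  row_mul i j l := by
    simp only [Finset.sum_mul_sum, Algebra.TensorProduct.tmul_mul_tmul, (isMagic_gen k).row_mul,
      TensorProduct.ite_tmul, Finset.sum_ite_eq, Finset.mem_univ, if_true]
    split_ifs <;> simp
  col_mul i j l := by
    simp only [Finset.sum_mul_sum, Algebra.TensorProduct.tmul_mul_tmul, (isMagic_gen k).col_mul,
      TensorProduct.tmul_ite, Finset.sum_ite_eq, Finset.mem_univ, if_true]
    split_ifs <;> simp
  row_sum i := by
    rw [Finset.sum_comm]
    simp only [← tmul_sum, (isMagic_gen k).row_sum, ← sum_tmul, Algebra.TensorProduct.one_def]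
  col_sum i := by
    rw [Finset.sum_comm]
    simp only [← sum_tmul, (isMagic_gen k).col_sum, ← tmul_sum, Algebra.TensorProduct.one_def]

lemma isMagic_counit : IsMagic fun i j : Fin n => if i = j then (1 : k) else 0 where
  row_mul i j l := by
    split_ifs <;> simp_all
  col_mul i j l := by
    split_ifs <;> simp_all
  row_sum i := by simp
  col_sum i := by simp

/-- `Δ (u i j) = ∑ l, u i l ⊗ u l j` and `ε (u i j) = δ i j`. -/
instance : Bialgebra k (MagicAlgebra k n) :=
  Bialgebra.ofAlgHom (lift _ isMagic_comul) (lift _ isMagic_counit)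
    (algHom_ext fun i j => by
      simp only [AlgHom.comp_apply, lift_gen, map_sum, Algebra.TensorProduct.map_tmul,
        AlgHom.id_apply, sum_tmul, tmul_sum]
      rw [Finset.sum_comm]
      rfl)
    (algHom_ext fun i j => by
      simp [ite_tmul])
    (algHom_ext fun i j => by
      simp [tmul_ite])

@[simp]
lemma comul_gen (i j : Fin n) :
    comul (R := k) (gen k i j) = ∑ l, gen k i l ⊗ₜ[k] gen k l j :=
  lift_gen (k := k) _ isMagic_comul i j

@[simp]
lemma counit_gen (i j : Fin n) : counit (R := k) (gen k i j) = if i = j then (1 : k) else 0 :=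
  lift_gen (k := k) _ isMagic_counit i j

lemma isMagic_antipode :
    IsMagic fun i j : Fin n => MulOpposite.op (gen k j i) where
  row_mul i j l := by
    rw [← MulOpposite.op_mul, (isMagic_gen k).col_mul]
    split_ifs <;> simp_all
  col_mul i j l := by
    rw [← MulOpposite.op_mul, (isMagic_gen k).row_mul]
    split_ifs <;> simp_all
  row_sum i := by
    rw [← Finset.op_sum, (isMagic_gen k).col_sum, MulOpposite.op_one]
  col_sum i := by
    rw [← Finset.op_sum, (isMagic_gen k).row_sum, MulOpposite.op_one]

/-- The antipode of `𝒜_s(n)`, the antihomomorphism with `S (u i j) = u j i`. -/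
def antipodeAux : MagicAlgebra k n →ₗ[k] MagicAlgebra k n :=
  (MulOpposite.opLinearEquiv k).symm.toLinearMap ∘ₗ
    (lift (k := k) (fun i j : Fin n => MulOpposite.op (gen k j i)) isMagic_antipode).toLinearMap

@[simp]
lemma antipodeAux_gen (i j : Fin n) : antipodeAux (gen k i j) = gen k j i := by
  simp [antipodeAux]

lemma antipodeAux_mul (x y : MagicAlgebra k n) :
    antipodeAux (x * y) = antipodeAux y * antipodeAux x := by
  simp [antipodeAux]

lemma antipodeAux_algebraMap (r : k) :
    antipodeAux (algebraMap k (MagicAlgebra k n) r) = algebraMap k _ r := by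
  simp [antipodeAux, Algebra.algebraMap_eq_smul_one]

lemma antipodeAux_one : antipodeAux (1 : MagicAlgebra k n) = 1 := by
  simp [antipodeAux]

lemma antipodeAux_left (x : MagicAlgebra k n) :
    LinearMap.mul' k _ (antipodeAux.rTensor _ (comul (R := k) x)) =
      algebraMap k _ (counit (R := k) x) := by
  induction x using induction with
  | hgen i j =>
    simp only [comul_gen, map_sum, LinearMap.rTensor_tmul, antipodeAux_gen,
      LinearMap.mul'_apply, (isMagic_gen k).row_mul, counit_gen]
    split_ifs <;> simp [(isMagic_gen k).col_sum]
  | hscalar r =>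
    simp [Algebra.TensorProduct.algebraMap_apply, antipodeAux_algebraMap]
  | hadd x y hx hy => simp only [map_add, hx, hy]
  | hmul x y hx hy =>
    rw [← (ℛ k x).eq] at hx
    rw [← (ℛ k y).eq] at hy
    rw [Bialgebra.comul_mul, Bialgebra.counit_mul, RingHom.map_mul, ← (ℛ k x).eq, ← (ℛ k y).eq]
    simp only [Finset.sum_mul_sum, map_sum, Algebra.TensorProduct.tmul_mul_tmul,
      LinearMap.rTensor_tmul, LinearMap.mul'_apply, antipodeAux_mul] at hx hy ⊢
    rw [Finset.sum_comm]
    trans ∑ j ∈ (ℛ k y).index, antipodeAux ((ℛ k y).left j) *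
      (∑ i ∈ (ℛ k x).index, antipodeAux ((ℛ k x).left i) * (ℛ k x).right i) * (ℛ k y).right j
    · simp only [Finset.mul_sum, Finset.sum_mul, mul_assoc]
    · rw [hx, ← hy, Finset.mul_sum]
      simp only [← Algebra.commutes, mul_assoc]

lemma antipodeAux_right (x : MagicAlgebra k n) :
    LinearMap.mul' k _ (antipodeAux.lTensor _ (comul (R := k) x)) =
      algebraMap k _ (counit (R := k) x) := by
  induction x using induction with
  | hgen i j =>
    simp only [comul_gen, map_sum, LinearMap.lTensor_tmul, antipodeAux_gen,
      LinearMap.mul'_apply, (isMagic_gen k).col_mul, counit_gen]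
    split_ifs <;> simp [(isMagic_gen k).row_sum]
  | hscalar r =>
    simp [Algebra.TensorProduct.algebraMap_apply, antipodeAux_one]
  | hadd x y hx hy => simp only [map_add, hx, hy]
  | hmul x y hx hy =>
    rw [← (ℛ k x).eq] at hx
    rw [← (ℛ k y).eq] at hy
    rw [Bialgebra.comul_mul, Bialgebra.counit_mul, RingHom.map_mul, ← (ℛ k x).eq, ← (ℛ k y).eq]
    simp only [Finset.sum_mul_sum, map_sum, Algebra.TensorProduct.tmul_mul_tmul,
      LinearMap.lTensor_tmul, LinearMap.mul'_apply, antipodeAux_mul] at hx hy ⊢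
    trans ∑ i ∈ (ℛ k x).index, (ℛ k x).left i *
      (∑ j ∈ (ℛ k y).index, (ℛ k y).left j * antipodeAux ((ℛ k y).right j)) *
        antipodeAux ((ℛ k x).right i)
    · simp only [Finset.mul_sum, Finset.sum_mul, mul_assoc]
    · rw [hy, ← hx, Finset.sum_mul]
      refine Finset.sum_congr rfl fun i _ => ?_
      rw [← Algebra.commutes, mul_assoc, Algebra.commutes]

instance : HopfAlgebra k (MagicAlgebra k n) where
  antipode := antipodeAux
  mul_antipode_rTensor_comul := LinearMap.ext antipodeAux_left
  mul_antipode_lTensor_comul := LinearMap.ext antipodeAux_right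

lemma antipode_gen (i j : Fin n) : antipode k (gen k i j) = gen k j i :=
  antipodeAux_gen i j

lemma antipode_antipode (x : MagicAlgebra k n) : antipode k (antipode k x) = x := by
  induction x using induction with
  | hgen i j => simp only [antipode_gen]
  | hscalar r => simp [Algebra.algebraMap_eq_smul_one]
  | hadd x y hx hy => simp only [map_add, hx, hy]
  | hmul x y hx hy => simp only [antipode_mul_antidistrib, hx, hy]

end MagicAlgebra

end Magic

/-! ### Quantum permutation algebras and their degree -/

section QPA

variable (k : Type u) [Field k] (H : Type v) [Ring H] [HopfAlgebra k H]

/-- `H` is a quotient Hopf algebra of `𝒜_s(n)`. A morphism of bialgebras between Hopf algebras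
automatically commutes with the antipodes, so that bialgebra morphisms are the morphisms of Hopf
algebras. -/
def IsQuotientOfMagic (n : ℕ) : Prop :=
  ∃ f : MagicAlgebra k n →ₐc[k] H, Function.Surjective f

/-- `H` is a quantum permutation algebra: a quotient Hopf algebra of some `𝒜_s(n)`, `n ≥ 1`. -/
def IsQuantumPermutationAlgebra : Prop :=
  ∃ n : ℕ, 1 ≤ n ∧ IsQuotientOfMagic k H n

/-- The degree of a quantum permutation algebra `H`: the smallest `n ≥ 1` such that `H` is a
quotient Hopf algebra of `𝒜_s(n)`. -/
def degree : ℕ := sInf {n : ℕ | 1 ≤ n ∧ IsQuotientOfMagic k H n}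

variable {k H}

lemma map_antipode {A : Type*} [Ring A] [HopfAlgebra k A] (f : A →ₐc[k] H) (a : A) :
    f (antipode k a) = antipode k (f a) := by
  have h : (f : A →ₗ[k] H) ∘ₗ antipode k = antipode k ∘ₗ (f : A →ₗ[k] H) := by
    apply WithConv.toConv_injective
    apply left_inv_eq_right_inv (a := WithConv.toConv (f : A →ₗ[k] H))
    · ext a
      rw [(ℛ k a).convMul_apply]
      have := congrArg f (sum_antipode_mul_eq_algebraMap_counit (ℛ k a))
      rw [map_sum, AlgHomClass.commutes] at this
      simpa using this
    · ext a
      rw [(ℛ k a).convMul_apply]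
      have := sum_mul_antipode_eq_algebraMap_counit ((ℛ k a).induced f)
      simpa using this
  exact LinearMap.congr_fun h a

/-- The antipode of a quantum permutation algebra satisfies `S ∘ S = id`. -/
lemma IsQuantumPermutationAlgebra.antipode_antipode (h : IsQuantumPermutationAlgebra k H) (x : H) :
    antipode k (antipode k x) = x := by
  obtain ⟨n, -, f, hf⟩ := h
  obtain ⟨a, rfl⟩ := hf x
  rw [← map_antipode, ← map_antipode, MagicAlgebra.antipode_antipode]

lemma IsQuantumPermutationAlgebra.antipode_bijective (h : IsQuantumPermutationAlgebra k H) :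
    Function.Bijective (antipode k : H →ₗ[k] H) :=
  Function.Involutive.bijective h.antipode_antipode

/-- The antipode of a group algebra is bijective. -/
lemma antipode_bijective_monoidAlgebra (G : Type w) [Group G] :
    Function.Bijective (antipode k : MonoidAlgebra k G →ₗ[k] MonoidAlgebra k G) := by
  refine Function.Involutive.bijective fun x => ?_
  have : (antipode k : MonoidAlgebra k G →ₗ[k] MonoidAlgebra k G) ∘ₗ antipode k =
      LinearMap.id := by
    ext g : 2
    simp
  exact LinearMap.congr_fun this x

end QPA

/-! ### The dual of a finite dimensional Hopf algebra -/

section DualHopf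

variable (k : Type u) [Field k] (H : Type v) [Ring H] [HopfAlgebra k H]

/-- The linear dual `H^*`, with the convolution product `(f * g)(x) = ∑ f(x₁) g(x₂)` as its
multiplication and the counit of `H` as its unit. -/
def HopfDual : Type (max u v) := WithConv (H →ₗ[k] k)

instance : Ring (HopfDual k H) := inferInstanceAs (Ring (WithConv (H →ₗ[k] k)))

instance : Algebra k (HopfDual k H) := inferInstanceAs (Algebra k (WithConv (H →ₗ[k] k)))

namespace HopfDual

/-- The elements of `H^*` are the linear forms on `H`. -/
def toDual : HopfDual k H ≃ₗ[k] (H →ₗ[k] k) := WithConv.linearEquiv k (H →ₗ[k] k)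

variable {k H}

instance : CoeFun (HopfDual k H) fun _ => H → k := ⟨fun f => toDual k H f⟩

lemma ext' {f g : HopfDual k H} (h : ∀ x, f x = g x) : f = g :=
  (toDual k H).injective (LinearMap.ext h)

@[simp]
lemma one_apply (x : H) : (1 : HopfDual k H) x = counit (R := k) x := rfl

lemma mul_apply {ι : Type*} (f g : HopfDual k H) {x : H} (r : Coalgebra.Repr k x ι) :
    (f * g) x = ∑ i ∈ r.index, f (r.left i) * g (r.right i) :=
  r.convMul_apply (A := k) (WithConv.toConv (toDual k H f)) (WithConv.toConv (toDual k H g))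

variable (k H) in
/-- The canonical map `H^* ⊗ H^* → (H ⊗ H)^*`. -/
def pairing : HopfDual k H ⊗[k] HopfDual k H →ₗ[k] (H ⊗[k] H →ₗ[k] k) :=
  TensorProduct.dualDistrib k H H ∘ₗ
    TensorProduct.map (toDual k H).toLinearMap (toDual k H).toLinearMap

@[simp]
lemma pairing_tmul (f g : HopfDual k H) (x y : H) :
    pairing k H (f ⊗ₜ g) (x ⊗ₜ y) = f x * g y := by
  simp [pairing]

lemma pairing_mul (s t : HopfDual k H ⊗[k] HopfDual k H) (x y : H) :
    pairing k H (s * t) (x ⊗ₜ y) = ∑ i ∈ (ℛ k x).index, ∑ j ∈ (ℛ k y).index,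
      pairing k H s ((ℛ k x).left i ⊗ₜ (ℛ k y).left j) *
        pairing k H t ((ℛ k x).right i ⊗ₜ (ℛ k y).right j) := by
  induction s with
  | zero => simp
  | add a b ha hb => simp only [map_add, LinearMap.add_apply, ha, hb, add_mul,
      Finset.sum_add_distrib]
  | tmul a b =>
    induction t with
    | zero => simp
    | add c d hc hd => simp only [map_add, LinearMap.add_apply, hc, hd, mul_add,
        Finset.sum_add_distrib]
    | tmul c d =>
      rw [Algebra.TensorProduct.tmul_mul_tmul]
      simp only [pairing_tmul, mul_apply _ _ (ℛ k x), mul_apply _ _ (ℛ k y), Finset.sum_mul_sum]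
      refine Finset.sum_congr rfl fun i _ => Finset.sum_congr rfl fun j _ => by ring

variable [FiniteDimensional k H]

instance : FiniteDimensional k (HopfDual k H) :=
  Module.Finite.equiv (toDual k H).symm

variable (k H) in
/-- For finite dimensional `H`, the canonical map `H^* ⊗ H^* → (H ⊗ H)^*` is an isomorphism. -/
def pairingEquiv : HopfDual k H ⊗[k] HopfDual k H ≃ₗ[k] (H ⊗[k] H →ₗ[k] k) :=
  (TensorProduct.congr (toDual k H) (toDual k H)).trans
    (TensorProduct.dualDistribEquiv k H H)

lemma pairingEquiv_apply (t : HopfDual k H ⊗[k] HopfDual k H) :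
    pairingEquiv k H t = pairing k H t := rfl

lemma tensor_ext {s t : HopfDual k H ⊗[k] HopfDual k H}
    (h : ∀ x y : H, pairing k H s (x ⊗ₜ y) = pairing k H t (x ⊗ₜ y)) : s = t := by
  apply (pairingEquiv k H).injective
  ext x y
  exact h x y

variable (k H) in
/-- For finite dimensional `H`, the canonical map `H^* ⊗ (H^* ⊗ H^*) → (H ⊗ (H ⊗ H))^*`. -/
def pairingEquiv₃ :
    HopfDual k H ⊗[k] (HopfDual k H ⊗[k] HopfDual k H) ≃ₗ[k] (H ⊗[k] (H ⊗[k] H) →ₗ[k] k) :=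
  (TensorProduct.congr (toDual k H) (pairingEquiv k H)).trans
    (TensorProduct.dualDistribEquiv k H (H ⊗[k] H))

lemma pairingEquiv₃_tmul (f : HopfDual k H) (t : HopfDual k H ⊗[k] HopfDual k H)
    (x : H) (u : H ⊗[k] H) :
    pairingEquiv₃ k H (f ⊗ₜ t) (x ⊗ₜ u) = f x * pairing k H t u := rfl

lemma tensor_ext₃ {s t : HopfDual k H ⊗[k] (HopfDual k H ⊗[k] HopfDual k H)}
    (h : ∀ x y z : H, pairingEquiv₃ k H s (x ⊗ₜ (y ⊗ₜ z)) =
      pairingEquiv₃ k H t (x ⊗ₜ (y ⊗ₜ z))) : s = t := by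
  apply (pairingEquiv₃ k H).injective
  ext x y z
  exact h x y z

/-- The comultiplication of `H^*` is dual to the multiplication of `H`:
`∑ f₁(x) f₂(y) = f(xy)`. The counit is evaluation at `1`. -/
instance : CoalgebraStruct k (HopfDual k H) where
  comul := (pairingEquiv k H).symm.toLinearMap ∘ₗ
    (LinearMap.lcomp k k (LinearMap.mul' k H)) ∘ₗ (toDual k H).toLinearMap
  counit := LinearMap.applyₗ (1 : H) ∘ₗ (toDual k H).toLinearMap

lemma counit_apply (f : HopfDual k H) : counit (R := k) f = f 1 := rfl

@[simp]
lemma pairing_comul (f : HopfDual k H) (x y : H) :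
    pairing k H (comul (R := k) f) (x ⊗ₜ y) = f (x * y) := by
  rw [← pairingEquiv_apply]
  simp [comul]

lemma sum_comul {ι : Type*} {f : HopfDual k H} (r : Coalgebra.Repr k f ι) (x y : H) :
    ∑ i ∈ r.index, r.left i x * r.right i y = f (x * y) := by
  rw [← pairing_comul, ← r.eq]
  simp

lemma pairing_rTensor_comul (s : HopfDual k H ⊗[k] HopfDual k H) (x y z : H) :
    pairingEquiv₃ k H (TensorProduct.assoc k _ _ _ ((comul (R := k)).rTensor _ s))
      (x ⊗ₜ (y ⊗ₜ z)) = pairing k H s ((x * y) ⊗ₜ z) := by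
  have aux : ∀ (t : HopfDual k H ⊗[k] HopfDual k H) (g : HopfDual k H),
      pairingEquiv₃ k H (TensorProduct.assoc k _ _ _ (t ⊗ₜ g)) (x ⊗ₜ (y ⊗ₜ z)) =
        pairing k H t (x ⊗ₜ y) * g z := by
    intro t g
    induction t with
    | zero => simp
    | add a b ha hb => simp only [add_tmul, map_add, LinearMap.add_apply, ha, hb, add_mul]
    | tmul a b => simp [pairingEquiv₃_tmul, mul_assoc]
  induction s with
  | zero => simp
  | add a b ha hb => simp only [map_add, LinearMap.add_apply, ha, hb]
  | tmul a b => simp [aux]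

lemma pairing_lTensor_comul (s : HopfDual k H ⊗[k] HopfDual k H) (x y z : H) :
    pairingEquiv₃ k H ((comul (R := k)).lTensor _ s) (x ⊗ₜ (y ⊗ₜ z)) =
      pairing k H s (x ⊗ₜ (y * z)) := by
  induction s with
  | zero => simp
  | add a b ha hb => simp only [map_add, LinearMap.add_apply, ha, hb]
  | tmul a b => simp [pairingEquiv₃_tmul]

instance : Coalgebra k (HopfDual k H) where
  coassoc := by
    refine LinearMap.ext fun f => tensor_ext₃ fun x y z => ?_
    simp only [LinearMap.comp_apply, LinearEquiv.coe_coe]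
    rw [pairing_rTensor_comul, pairing_lTensor_comul, pairing_comul, pairing_comul, mul_assoc]
  rTensor_counit_comp_comul := by
    refine LinearMap.ext fun f => ?_
    apply (TensorProduct.lid k (HopfDual k H)).injective
    refine ext' fun x => ?_
    simp only [LinearMap.comp_apply]
    rw [← (ℛ k f).eq]
    simpa [counit_apply] using sum_comul (ℛ k f) 1 x
  lTensor_counit_comp_comul := by
    refine LinearMap.ext fun f => ?_
    apply (TensorProduct.rid k (HopfDual k H)).injective
    refine ext' fun x => ?_
    simp only [LinearMap.comp_apply]
    rw [← (ℛ k f).eq]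
    simpa [counit_apply, mul_comm] using sum_comul (ℛ k f) x 1

instance : Bialgebra k (HopfDual k H) :=
  Bialgebra.mk' k (HopfDual k H)
    (by simp [counit_apply])
    (by
      intro f g
      rw [counit_apply, mul_apply f g (x := (1 : H)) (ι := Unit)
        ⟨{()}, fun _ => 1, fun _ => 1, by simp [Algebra.TensorProduct.one_def]⟩]
      simp [counit_apply])
    (by
      refine tensor_ext fun x y => ?_
      simp [Algebra.TensorProduct.one_def])
    (by
      intro f g
      refine tensor_ext fun x y => ?_
      rw [pairing_mul, pairing_comul, mul_apply f g ((ℛ k x).mul (ℛ k y))]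
      simp [Coalgebra.Repr.mul, Finset.sum_product])

/-- The antipode of `H^*` is the transpose of the antipode of `H`. -/
instance : HopfAlgebra k (HopfDual k H) where
  antipode := (toDual k H).symm.toLinearMap ∘ₗ
    (LinearMap.lcomp k k (antipode k)) ∘ₗ (toDual k H).toLinearMap
  mul_antipode_rTensor_comul := by
    refine LinearMap.ext fun f => ext' fun x => ?_
    simp only [LinearMap.comp_apply]
    rw [← (ℛ k f).eq]
    have h := sum_antipode_mul_eq_algebraMap_counit (ℛ k x)
    have h' := congrArg (toDual k H f) h
    simp only [map_sum, ← sum_comul (ℛ k f)] at h'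
    rw [Finset.sum_comm] at h'
    simp only [map_sum, LinearMap.rTensor_tmul, LinearMap.mul'_apply, map_sum,
      LinearMap.sum_apply, mul_apply _ _ (ℛ k x)]
    simpa [counit_apply, Algebra.algebraMap_eq_smul_one, mul_comm] using h'
  mul_antipode_lTensor_comul := by
    refine LinearMap.ext fun f => ext' fun x => ?_
    simp only [LinearMap.comp_apply]
    rw [← (ℛ k f).eq]
    have h := sum_mul_antipode_eq_algebraMap_counit (ℛ k x)
    have h' := congrArg (toDual k H f) h
    simp only [map_sum, ← sum_comul (ℛ k f)] at h'
    rw [Finset.sum_comm] at h'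
    simp only [map_sum, LinearMap.lTensor_tmul, LinearMap.mul'_apply, map_sum,
      LinearMap.sum_apply, mul_apply _ _ (ℛ k x)]
    simpa [counit_apply, Algebra.algebraMap_eq_smul_one, mul_comm] using h'

lemma antipode_apply (f : HopfDual k H) (x : H) : antipode k f x = f (antipode k x) := rfl

end HopfDual
end DualHopf
/-! ### The Drinfeld double -/

section Double

variable {k : Type u} [Field k] {H : Type v} [Ring H] [HopfAlgebra k H]

namespace HopfDual

/-- The left action `h ⇀ f` of `H` on `H^*`: `(h ⇀ f)(x) = f(xh)`. -/
def leftHit : H →ₗ[k] HopfDual k H →ₗ[k] HopfDual k H :=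
  LinearMap.mk₂ k (fun h f => (toDual k H).symm (toDual k H f ∘ₗ LinearMap.mulRight k h))
    (fun h h' f => ext' fun x => by simp [mul_add])
    (fun c h f => ext' fun x => by simp)
    (fun h f g => ext' fun x => by simp)
    (fun c h f => ext' fun x => by simp)

/-- The right action `f ↼ h` of `H` on `H^*`: `(f ↼ h)(x) = f(hx)`. -/
def rightHit : H →ₗ[k] HopfDual k H →ₗ[k] HopfDual k H :=
  LinearMap.mk₂ k (fun h f => (toDual k H).symm (toDual k H f ∘ₗ LinearMap.mulLeft k h))
    (fun h h' f => ext' fun x => by simp [add_mul])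
    (fun c h f => ext' fun x => by simp)
    (fun h f g => ext' fun x => by simp)
    (fun c h f => ext' fun x => by simp)

@[simp]
lemma leftHit_apply (h : H) (f : HopfDual k H) (x : H) : leftHit h f x = f (x * h) := by
  simp [leftHit]

@[simp]
lemma rightHit_apply (h : H) (f : HopfDual k H) (x : H) : rightHit h f x = f (h * x) := by
  simp [rightHit]

end HopfDual

open HopfDual

variable (hS : Function.Bijective (antipode k : H →ₗ[k] H))

/-- The composition inverse `S⁻¹` of a bijective antipode. -/
def antipodeInv : H →ₗ[k] H := (LinearEquiv.ofBijective (antipode k : H →ₗ[k] H) hS).symm.toLinearMap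

@[simp]
lemma antipode_antipodeInv (x : H) : antipode k (antipodeInv hS x) = x :=
  (LinearEquiv.ofBijective (antipode k : H →ₗ[k] H) hS).apply_symm_apply x

lemma antipodeInv_mul (x y : H) :
    antipodeInv hS (x * y) = antipodeInv hS y * antipodeInv hS x := by
  apply hS.injective
  simp [antipode_mul_antidistrib]

lemma antipodeInv_one : antipodeInv hS (1 : H) = 1 := by
  apply hS.injective
  simp

lemma counit_antipodeInv (x : H) : counit (R := k) (antipodeInv hS x) = counit (R := k) x := by
  rw [← counit_antipode, antipode_antipodeInv]

lemma sum_antipodeInv_mul {ι : Type*} {x : H} (r : Coalgebra.Repr k x ι) :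
    ∑ i ∈ r.index, antipodeInv hS (r.right i) * r.left i = algebraMap k H (counit x) := by
  apply hS.injective
  simp only [map_sum, antipode_mul_antidistrib, antipode_antipodeInv]
  rw [sum_antipode_mul_eq_algebraMap_counit]
  simp [Algebra.algebraMap_eq_smul_one]

lemma sum_mul_antipodeInv {ι : Type*} {x : H} (r : Coalgebra.Repr k x ι) :
    ∑ i ∈ r.index, r.right i * antipodeInv hS (r.left i) = algebraMap k H (counit x) := by
  apply hS.injective
  simp only [map_sum, antipode_mul_antidistrib, antipode_antipodeInv]
  rw [sum_mul_antipode_eq_algebraMap_counit]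
  simp [Algebra.algebraMap_eq_smul_one]

lemma pairing_map_hit (u v : HopfDual k H →ₗ[k] HopfDual k H) (u' v' : H → H)
    (hu : ∀ f x, toDual k H (u f) x = toDual k H f (u' x))
    (hv : ∀ f x, toDual k H (v f) x = toDual k H f (v' x)) (x y : H)
    (s : HopfDual k H ⊗[k] HopfDual k H) :
    pairing k H (TensorProduct.map u v s) (x ⊗ₜ y) = pairing k H s (u' x ⊗ₜ v' y) := by
  induction s with
  | zero => simp
  | add a b ha hb => simp only [map_add, LinearMap.add_apply, ha, hb]
  | tmul a b => simp [hu, hv]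

/-- The transpose of `S⁻¹`, which is the antipode of `H^{*cop}`. -/
def dualAntipodeInv : HopfDual k H →ₗ[k] HopfDual k H :=
  (toDual k H).symm.toLinearMap ∘ₗ LinearMap.lcomp k k (antipodeInv hS) ∘ₗ
    (toDual k H).toLinearMap

@[simp]
lemma dualAntipodeInv_apply (f : HopfDual k H) (x : H) :
    toDual k H (dualAntipodeInv hS f) x = f (antipodeInv hS x) := by
  simp [dualAntipodeInv]

/-- The map `a ⊗ b ⊗ c ↦ (f ↦ (a ⇀ f ↼ S⁻¹(c)) ⊗ b)`. -/
def crossAux : H →ₗ[k] H →ₗ[k] H →ₗ[k] HopfDual k H →ₗ[k] HopfDual k H ⊗[k] H where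
  toFun a := LinearMap.mk₂ k
    (fun b c => (TensorProduct.mk k (HopfDual k H) H).flip b ∘ₗ leftHit a ∘ₗ
      rightHit (antipodeInv hS c))
    (fun b b' c => by ext f; simp)
    (fun r b c => by ext f; simp)
    (fun b c c' => by ext f; simp)
    (fun r b c => by ext f; simp [smul_tmul'])
  map_add' a a' := by ext b c f; simp
  map_smul' r a := by ext b c f; simp [smul_tmul']

lemma crossAux_apply (a b c : H) (f : HopfDual k H) :
    crossAux hS a b c f = leftHit a (rightHit (antipodeInv hS c) f) ⊗ₜ[k] b := rfl

/-- The straightening map `h ↦ (f ↦ ∑ (h₁ ⇀ f ↼ S⁻¹(h₃)) ⊗ h₂)`. -/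
def cross : H →ₗ[k] HopfDual k H →ₗ[k] HopfDual k H ⊗[k] H :=
  TensorProduct.lift (TensorProduct.lift (crossAux hS)) ∘ₗ
    (comul (R := k)).rTensor H ∘ₗ comul (R := k)

lemma cross_apply (h : H) (f : HopfDual k H) :
    cross hS h f = ∑ i ∈ (ℛ k h).index, ∑ j ∈ (ℛ k ((ℛ k h).left i)).index,
      leftHit ((ℛ k ((ℛ k h).left i)).left j)
        (rightHit (antipodeInv hS ((ℛ k h).right i)) f) ⊗ₜ[k]
          (ℛ k ((ℛ k h).left i)).right j := by
  rw [cross, LinearMap.comp_apply, LinearMap.comp_apply, ← (ℛ k h).eq]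
  simp only [map_sum, LinearMap.rTensor_tmul, TensorProduct.lift.tmul, LinearMap.sum_apply]
  refine Finset.sum_congr rfl fun i _ => ?_
  rw [← (ℛ k ((ℛ k h).left i)).eq]
  simp [crossAux_apply]
section Compatible

variable {B : Type*} [Ring B] [Algebra k B]

/-- Compatibility of linear maps `α : H → B` and `β : H^* → B`:
`∑ α(h₁) β(f ↼ h₂) = ∑ β(h₁ ⇀ f) α(h₂)` for all `h` and `f`. The sums are written as convolution
products of linear maps `H → B`. -/
def Compatible (α : H →ₗ[k] B) (β : HopfDual k H →ₗ[k] B) : Prop :=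
  ∀ f : HopfDual k H,
    (WithConv.toConv α * WithConv.toConv (β ∘ₗ rightHit.flip f) : WithConv (H →ₗ[k] B)) =
      WithConv.toConv (β ∘ₗ leftHit.flip f) * WithConv.toConv α

lemma Compatible.sum_eq {α : H →ₗ[k] B} {β : HopfDual k H →ₗ[k] B} (hc : Compatible α β)
    (f : HopfDual k H) {ι : Type*} {h : H} (r : Coalgebra.Repr k h ι) :
    ∑ i ∈ r.index, α (r.left i) * β (rightHit (r.right i) f) =
      ∑ i ∈ r.index, β (leftHit (r.left i) f) * α (r.right i) := by
  have := congrArg (fun F : WithConv (H →ₗ[k] B) => F h) (hc f)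
  simpa only [r.convMul_apply, LinearMap.comp_apply, LinearMap.flip_apply] using this

lemma compatible_of_sum {α : H →ₗ[k] B} {β : HopfDual k H →ₗ[k] B}
    (hc : ∀ (f : HopfDual k H) (h : H),
      ∑ i ∈ (ℛ k h).index, α ((ℛ k h).left i) * β (rightHit ((ℛ k h).right i) f) =
      ∑ i ∈ (ℛ k h).index, β (leftHit ((ℛ k h).left i) f) * α ((ℛ k h).right i)) :
    Compatible α β := by
  intro f
  ext h
  simpa only [(ℛ k h).convMul_apply, LinearMap.comp_apply, LinearMap.flip_apply] using hc f h

/-- The map `f ⊗ h ↦ β(f) α(h)`. -/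
def liftAux (α : H →ₗ[k] B) (β : HopfDual k H →ₗ[k] B) : HopfDual k H ⊗[k] H →ₗ[k] B :=
  LinearMap.mul' k B ∘ₗ TensorProduct.map β α

@[simp]
lemma liftAux_tmul (α : H →ₗ[k] B) (β : HopfDual k H →ₗ[k] B) (f : HopfDual k H) (h : H) :
    liftAux α β (f ⊗ₜ h) = β f * α h := by
  simp [liftAux]

lemma rightHit_mul (a b : H) (f : HopfDual k H) :
    rightHit b (rightHit a f) = rightHit (a * b) f :=
  ext' fun x => by simp [mul_assoc]

lemma rightHit_one (f : HopfDual k H) : rightHit 1 f = f :=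
  ext' fun x => by simp

lemma Compatible.mul_eq {α : H →ₗ[k] B} {β : HopfDual k H →ₗ[k] B} (hc : Compatible α β)
    (h : H) (f : HopfDual k H) : α h * β f = liftAux α β (cross hS h f) := by
  rw [cross_apply]
  simp only [map_sum, liftAux_tmul]
  simp only [← hc.sum_eq]
  let T : H ⊗[k] (H ⊗[k] H) →ₗ[k] B :=
    LinearMap.mul' k B ∘ₗ TensorProduct.map α
      (β ∘ₗ rightHit.flip f ∘ₗ LinearMap.mul' k H ∘ₗ (TensorProduct.comm k H H).toLinearMap ∘ₗ
        (antipodeInv hS).lTensor H)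
  have hT : ∀ a b c : H, T (a ⊗ₜ (b ⊗ₜ c)) = α a * β (rightHit (antipodeInv hS c * b) f) := by
    intro a b c
    simp [T]
  have key := congrArg T (sum_tmul_tmul_eq (ℛ k h) (fun i => ℛ k ((ℛ k h).left i))
    (fun i => ℛ k ((ℛ k h).right i)))
  simp only [map_sum, hT] at key
  simp only [rightHit_mul]
  rw [key]
  simp only [← Finset.mul_sum, ← map_sum, ← LinearMap.sum_apply]
  have : ∀ i, ∑ j ∈ (ℛ k ((ℛ k h).right i)).index,
      antipodeInv hS ((ℛ k ((ℛ k h).right i)).right j) * (ℛ k ((ℛ k h).right i)).left j =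
      algebraMap k H (counit ((ℛ k h).right i)) := fun i => sum_antipodeInv_mul hS _
  simp only [this, Algebra.algebraMap_eq_smul_one, map_smul, LinearMap.smul_apply, rightHit_one]
  have h2 := congrArg (TensorProduct.rid k H) (sum_tmul_counit_eq (ℛ k h))
  simp only [map_sum, rid_tmul, one_smul] at h2
  conv_lhs => rw [← h2]
  simp [Finset.sum_mul]

lemma Compatible.algHom_comp {B C : Type*} [Ring B] [Algebra k B]
    [Ring C] [Algebra k C] {α : H →ₗ[k] B} {β : HopfDual k H →ₗ[k] B} (hc : Compatible α β)
    (F : B →ₐ[k] C) : Compatible (F.toLinearMap ∘ₗ α) (F.toLinearMap ∘ₗ β) := by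
  refine compatible_of_sum fun f h => ?_
  have := congrArg F (hc.sum_eq f (ℛ k h))
  simpa using this

end Compatible

/-! #### A faithful representation, used to verify the associativity of the double -/

namespace DoubleRep

variable (k H) in
/-- The space of linear endomorphisms of `H`, with the convolution product. -/
abbrev V := WithConv (H →ₗ[k] H)

/-- `h` acts by `G ↦ (x ↦ G(xh))`. -/
def opA : H →ₐ[k] Module.End k (V k H) :=
  AlgHom.ofLinearMap
    (LinearMap.mk₂ k (fun h G => WithConv.toConv (G.ofConv ∘ₗ LinearMap.mulRight k h))
      (fun h h' f => by ext x; simp [mul_add])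
      (fun c h f => by ext x; simp)
      (fun h f g => by ext x; simp)
      (fun c h f => by ext x; simp))
    (by ext G x; simp)
    (fun a b => by ext G x; simp [mul_assoc])

/-- `h` acts by `G ↦ (x ↦ h G(x))`. -/
def opL : H →ₐ[k] Module.End k (V k H) :=
  AlgHom.ofLinearMap
    (LinearMap.mk₂ k (fun h G => WithConv.toConv (LinearMap.mulLeft k h ∘ₗ G.ofConv))
      (fun h h' f => by ext x; simp [add_mul])
      (fun c h f => by ext x; simp)
      (fun h f g => by ext x; simp [mul_add])
      (fun c h f => by ext x; simp))
    (by ext G x; simp)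
    (fun a b => by ext G x; simp)

/-- `h` acts by `G ↦ (x ↦ G(hx))`. -/
def opB' : H →ₗ[k] Module.End k (V k H) :=
  LinearMap.mk₂ k (fun h G => WithConv.toConv (G.ofConv ∘ₗ LinearMap.mulLeft k h))
      (fun h h' f => by ext x; simp [add_mul])
      (fun c h f => by ext x; simp)
      (fun h f g => by ext x; simp)
      (fun c h f => by ext x; simp)

@[simp] lemma opA_apply (h : H) (G : V k H) (x : H) : (opA h G).ofConv x = G.ofConv (x * h) := rfl
@[simp] lemma opL_apply (h : H) (G : V k H) (x : H) : (opL h G).ofConv x = h * G.ofConv x := rfl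
@[simp] lemma opB'_apply (h : H) (G : V k H) (x : H) : (opB' h G).ofConv x = G.ofConv (h * x) := rfl

/-- `h` acts by `G ↦ (x ↦ G(S⁻¹(h)x))`. -/
def opB : H →ₐ[k] Module.End k (V k H) :=
  AlgHom.ofLinearMap (opB' ∘ₗ antipodeInv hS)
    (by ext G x; simp [antipodeInv_one])
    (fun a b => by ext G x; simp [antipodeInv_mul, mul_assoc])

@[simp] lemma opB_apply (h : H) (G : V k H) (x : H) :
    (opB hS h G).ofConv x = G.ofConv (antipodeInv hS h * x) := rfl

/-- A linear form, viewed as an endomorphism with scalar values. -/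
def scalar : HopfDual k H →ₐ[k] V k H :=
  AlgHom.ofLinearMap
    ((WithConv.linearEquiv k (H →ₗ[k] H)).symm.toLinearMap ∘ₗ
      LinearMap.llcomp k H k H (Algebra.linearMap k H) ∘ₗ (toDual k H).toLinearMap)
    (by ext x; simp)
    (fun f g => by
      ext x
      have := mul_apply f g (ℛ k x)
      rw [(ℛ k x).convMul_apply]
      simp [this])

@[simp] lemma scalar_apply (f : HopfDual k H) (x : H) :
    (scalar f).ofConv x = algebraMap k H (f x) := rfl

/-- `f` acts by `G ↦ (x ↦ ∑ f(x₁) G(x₂))`. -/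
def opF : HopfDual k H →ₐ[k] Module.End k (V k H) := (Algebra.lmul k (V k H)).comp scalar

lemma opF_apply {ι : Type*} (f : HopfDual k H) (G : V k H) {x : H} (r : Coalgebra.Repr k x ι) :
    (opF f G).ofConv x = ∑ i ∈ r.index, f (r.left i) • G.ofConv (r.right i) := by
  have : opF f G = scalar f * G := rfl
  rw [this]
  erw [r.convMul_apply]
  simp [Algebra.smul_def]

/-- The constant family. -/
def const {B : Type*} [Ring B] [Algebra k B] (b : B) : WithConv (H →ₗ[k] B) :=
  WithConv.toConv ((LinearMap.toSpanSingleton k B b) ∘ₗ counit (R := k))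

lemma conv_apply {B : Type*} [Ring B] [Algebra k B] (F G : WithConv (H →ₗ[k] B)) (h : H) :
    (F * G).ofConv h = ∑ i ∈ (ℛ k h).index, F.ofConv ((ℛ k h).left i) * G.ofConv ((ℛ k h).right i) :=
  (ℛ k h).convMul_apply F G

lemma mul_const {B : Type*} [Ring B] [Algebra k B] (F : WithConv (H →ₗ[k] B)) (b : B) (h : H) :
    (F * const b).ofConv h = F.ofConv h * b := by
  refine ((ℛ k h).convMul_apply F (const b)).trans ?_
  have h2 := congrArg (TensorProduct.rid k H) (sum_tmul_counit_eq (ℛ k h))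
  simp only [map_sum, rid_tmul, one_smul] at h2
  conv_rhs => rw [← h2]
  simp [const, Finset.sum_mul]

lemma const_mul {B : Type*} [Ring B] [Algebra k B] (F : WithConv (H →ₗ[k] B)) (b : B) (h : H) :
    (const b * F).ofConv h = b * F.ofConv h := by
  refine ((ℛ k h).convMul_apply (const b) F).trans ?_
  have h2 := congrArg (TensorProduct.lid k H) (sum_counit_tmul_eq (ℛ k h))
  simp only [map_sum, lid_tmul, one_smul] at h2
  conv_rhs => rw [← h2]
  simp [const, Finset.mul_sum]

lemma commute_const {B : Type*} [Ring B] [Algebra k B] (F : WithConv (H →ₗ[k] B)) (b : B)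
    (hF : ∀ h, F.ofConv h * b = b * F.ofConv h) : F * const b = const b * F := by
  ext h
  rw [mul_const, const_mul, hF]

/-- `opB` is the convolution inverse of `opB'`. -/
lemma opB_mul_opB' :
    (WithConv.toConv (opB hS).toLinearMap * WithConv.toConv opB' :
      WithConv (H →ₗ[k] Module.End k (V k H))) = 1 := by
  ext h G x
  rw [(ℛ k h).convMul_apply]
  have h1 := sum_mul_antipodeInv hS (ℛ k h)
  have h2 : ∑ i ∈ (ℛ k h).index, (ℛ k h).right i * antipodeInv hS ((ℛ k h).left i) * x =
      algebraMap k H (counit h) * x := by rw [← Finset.sum_mul, h1]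
  have h3 := congrArg G.ofConv h2
  rw [map_sum] at h3
  simp only [LinearMap.sum_apply, WithConv.ofConv_sum]
  simpa [Algebra.algebraMap_eq_smul_one, mul_assoc] using h3

lemma opB'_mul_opB :
    (WithConv.toConv opB' * WithConv.toConv (opB hS).toLinearMap :
      WithConv (H →ₗ[k] Module.End k (V k H))) = 1 := by
  ext h G x
  rw [(ℛ k h).convMul_apply]
  have h1 := sum_antipodeInv_mul hS (ℛ k h)
  have h2 : ∑ i ∈ (ℛ k h).index, antipodeInv hS ((ℛ k h).right i) * (ℛ k h).left i * x =
      algebraMap k H (counit h) * x := by rw [← Finset.sum_mul, h1]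
  have h3 := congrArg G.ofConv h2
  rw [map_sum] at h3
  simp only [LinearMap.sum_apply, WithConv.ofConv_sum]
  simpa [Algebra.algebraMap_eq_smul_one, mul_assoc] using h3

lemma relA (f : HopfDual k H) :
    (WithConv.toConv opA.toLinearMap * const (opF f) : WithConv (H →ₗ[k] Module.End k (V k H))) =
      WithConv.toConv (opF.toLinearMap ∘ₗ leftHit.flip f) * WithConv.toConv opA.toLinearMap := by
  ext h G x
  rw [mul_const, (ℛ k h).convMul_apply]
  simp only [LinearMap.sum_apply, WithConv.ofConv_sum, Module.End.mul_apply, AlgHom.toLinearMap_apply,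
    LinearMap.comp_apply, LinearMap.flip_apply, opA_apply, opF_apply _ _ (ℛ k x),
    opF_apply _ _ ((ℛ k x).mul (ℛ k h)), leftHit_apply]
  simp [Coalgebra.Repr.mul, Finset.sum_product_right]

lemma relB' (f : HopfDual k H) :
    (WithConv.toConv opB' * const (opF f) : WithConv (H →ₗ[k] Module.End k (V k H))) =
      WithConv.toConv (opF.toLinearMap ∘ₗ rightHit.flip f) * WithConv.toConv opB' := by
  ext h G x
  rw [mul_const, (ℛ k h).convMul_apply]
  simp only [LinearMap.sum_apply, WithConv.ofConv_sum, Module.End.mul_apply, AlgHom.toLinearMap_apply,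
    LinearMap.comp_apply, LinearMap.flip_apply, opB'_apply, opF_apply _ _ (ℛ k x),
    opF_apply _ _ ((ℛ k h).mul (ℛ k x)), rightHit_apply]
  simp [Coalgebra.Repr.mul, Finset.sum_product]

lemma relB (f : HopfDual k H) :
    (WithConv.toConv (opB hS).toLinearMap * WithConv.toConv (opF.toLinearMap ∘ₗ rightHit.flip f) :
        WithConv (H →ₗ[k] Module.End k (V k H))) =
      const (opF f) * WithConv.toConv (opB hS).toLinearMap := by
  have h := congrArg (fun F => WithConv.toConv (opB hS).toLinearMap * F *
    WithConv.toConv (opB hS).toLinearMap) (relB' f)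
  rw [← mul_assoc, opB_mul_opB', one_mul, mul_assoc, mul_assoc, opB'_mul_opB, mul_one] at h
  exact h.symm

lemma relL (f : HopfDual k H) :
    (WithConv.toConv opL.toLinearMap * const (opF f) : WithConv (H →ₗ[k] Module.End k (V k H))) =
      const (opF f) * WithConv.toConv opL.toLinearMap := by
  refine commute_const _ _ fun h => ?_
  ext G x
  simp [opF_apply _ _ (ℛ k x), Finset.mul_sum]

lemma commute_LB (a b : H) : Commute (opL a) (opB hS b) := by
  ext G x; simp

lemma commute_AL (a b : H) : Commute (opA (k := k) a) (opL b) := by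
  ext G x; simp

lemma commute_AB (a b : H) : Commute (opA a) (opB hS b) := by
  ext G x; simp [mul_assoc]

/-- `h` acts by `G ↦ (x ↦ ∑ h₁ G(S⁻¹(h₂) x))`. -/
def opLB : H →ₐ[k] Module.End k (V k H) :=
  (Algebra.TensorProduct.lift opL (opB hS) (commute_LB hS)).comp (Bialgebra.comulAlgHom k H)

lemma opLB_apply (h : H) : opLB hS h =
    ∑ i ∈ (ℛ k h).index, opL ((ℛ k h).left i) * opB hS ((ℛ k h).right i) := by
  show Algebra.TensorProduct.lift opL (opB hS) (commute_LB hS) (comul h) = _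
  rw [← (ℛ k h).eq]
  simp

lemma commute_ALB (a b : H) : Commute (opA a) (opLB hS b) := by
  rw [opLB_apply]
  exact Commute.sum_right _ _ _ fun i _ => (commute_AL _ _).mul_right (commute_AB hS _ _)

/-- `h` acts by `G ↦ (x ↦ ∑ h₂ G(S⁻¹(h₃) x h₁))`. -/
def opH : H →ₐ[k] Module.End k (V k H) :=
  (Algebra.TensorProduct.lift opA (opLB hS) (commute_ALB hS)).comp (Bialgebra.comulAlgHom k H)

lemma opH_apply (h : H) : opH hS h =
    ∑ i ∈ (ℛ k h).index, opA ((ℛ k h).left i) * opLB hS ((ℛ k h).right i) := by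
  show Algebra.TensorProduct.lift opA (opLB hS) (commute_ALB hS) (comul h) = _
  rw [← (ℛ k h).eq]
  simp

lemma opH_eq : WithConv.toConv (opH hS).toLinearMap =
    (WithConv.toConv opA.toLinearMap * (WithConv.toConv opL.toLinearMap *
      WithConv.toConv (opB hS).toLinearMap) : WithConv (H →ₗ[k] Module.End k (V k H))) := by
  have aux : (WithConv.toConv opL.toLinearMap * WithConv.toConv (opB hS).toLinearMap :
      WithConv (H →ₗ[k] Module.End k (V k H))) = WithConv.toConv (opLB hS).toLinearMap := by
    apply WithConv.ext
    refine LinearMap.ext fun h => ?_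
    rw [conv_apply]
    exact (opLB_apply hS h).symm
  rw [aux]
  apply WithConv.ext
  refine LinearMap.ext fun h => ?_
  rw [conv_apply]
  exact opH_apply hS h

lemma compatible_aux {M : Type*} [Monoid M] {a l b c p q : M} (hb : b * q = c * b)
    (hl : l * c = c * l) (ha : a * c = p * a) : a * (l * b) * q = p * (a * (l * b)) := by
  rw [mul_assoc, mul_assoc, hb, ← mul_assoc l, hl, mul_assoc, ← mul_assoc, ha, mul_assoc]

lemma compatible : Compatible (opH hS).toLinearMap (opF (k := k) (H := H)).toLinearMap := by
  intro f
  rw [opH_eq]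
  exact compatible_aux (relB hS f) (relL f) (relA f)

lemma opLB_one (h : H) : opLB hS h 1 = opL h 1 := by
  rw [opLB_apply]
  have h2 := congrArg (TensorProduct.rid k H) (sum_tmul_counit_eq (ℛ k h))
  simp only [map_sum, rid_tmul, one_smul] at h2
  conv_rhs => rw [← h2]
  ext x
  simp [counit_antipodeInv, Algebra.algebraMap_eq_smul_one, smul_smul, mul_comm]

lemma opH_one (h : H) : opH hS h 1 = opL h 1 := by
  rw [opH_apply]
  have h2 := congrArg (TensorProduct.lid k H) (sum_counit_tmul_eq (ℛ k h))
  simp only [map_sum, lid_tmul, one_smul] at h2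
  conv_rhs => rw [← h2]
  ext x
  simp [opLB_one, Algebra.algebraMap_eq_smul_one, smul_smul, mul_comm]

/-- The representation of `H^* ⊗ H` given by `f ⊗ h ↦ opF f ∘ opH h`. -/
def rep : HopfDual k H ⊗[k] H →ₗ[k] Module.End k (V k H) :=
  liftAux (opH hS).toLinearMap opF.toLinearMap

lemma rep_one_apply (f : HopfDual k H) (h x : H) :
    (rep hS (f ⊗ₜ h) 1).ofConv x = f x • h := by
  have h2 := congrArg (TensorProduct.rid k H) (sum_tmul_counit_eq (ℛ k x))
  simp only [map_sum, rid_tmul, one_smul] at h2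
  conv_rhs => rw [← h2]
  simp [rep, opH_one, opF_apply _ _ (ℛ k x), Algebra.algebraMap_eq_smul_one, Finset.sum_smul,
    smul_smul, mul_comm]

lemma rep_injective [FiniteDimensional k H] : Function.Injective (rep hS) := by
  have key : ∀ t : HopfDual k H ⊗[k] H, (rep hS t 1).ofConv =
      (TensorProduct.congr (toDual k H) (LinearEquiv.refl k H)).trans
        (dualTensorHomEquiv k H H) t := by
    intro t
    induction t with
    | zero => simp
    | add a b ha hb => simp only [map_add, LinearMap.add_apply, WithConv.ofConv_add, ha, hb]
    | tmul f h =>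
      ext x
      rw [rep_one_apply]
      simp
  intro s t hst
  apply ((TensorProduct.congr (toDual k H) (LinearEquiv.refl k H)).trans
    (dualTensorHomEquiv k H H)).injective
  rw [← key, ← key, hst]

end DoubleRep
/-- The Drinfeld double `D(H)` of a finite dimensional Hopf algebra `H` with bijective antipode (in
finite dimension every antipode is bijective; the proof `_hS` serves to form `S⁻¹`), on the vector
space `H^* ⊗ H`. As a coalgebra it is `H^{*cop} ⊗ H`, and its multiplication is
`(f ⊗ h)(f' ⊗ h') = ∑ f (h₁ ⇀ f' ↼ S⁻¹(h₃)) ⊗ h₂ h'`. -/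
def DrinfeldDouble (k : Type u) [Field k] (H : Type v) [Ring H] [HopfAlgebra k H]
    (_hS : Function.Bijective (antipode k : H →ₗ[k] H)) : Type (max u v) :=
  HopfDual k H ⊗[k] H

namespace DrinfeldDouble

instance : AddCommGroup (DrinfeldDouble k H hS) :=
  inferInstanceAs (AddCommGroup (HopfDual k H ⊗[k] H))

instance : Module k (DrinfeldDouble k H hS) :=
  inferInstanceAs (Module k (HopfDual k H ⊗[k] H))

/-- The identification of the underlying vector space of `D(H)` with `H^* ⊗ H`. -/
def toTensor : DrinfeldDouble k H hS ≃ₗ[k] HopfDual k H ⊗[k] H :=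
  LinearEquiv.refl k (HopfDual k H ⊗[k] H)

/-- The element `f ⊗ h` of `D(H)`. -/
def mk (f : HopfDual k H) (h : H) : DrinfeldDouble k H hS := (toTensor hS).symm (f ⊗ₜ[k] h)

@[elab_as_elim]
lemma induction_on {P : DrinfeldDouble k H hS → Prop} (x : DrinfeldDouble k H hS)
    (zero : P 0) (mk' : ∀ f h, P (mk hS f h)) (add : ∀ x y, P x → P y → P (x + y)) : P x :=
  TensorProduct.induction_on x zero mk' add

/-- The bilinear multiplication of `D(H)`:
`(f ⊗ h, f' ⊗ h') ↦ ∑ f (h₁ ⇀ f' ↼ S⁻¹(h₃)) ⊗ h₂ h'`. -/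
def mulMap : HopfDual k H ⊗[k] H →ₗ[k] HopfDual k H ⊗[k] H →ₗ[k] HopfDual k H ⊗[k] H :=
  TensorProduct.lift <| LinearMap.mk₂ k
    (fun f h => TensorProduct.lift <| LinearMap.mk₂ k
      (fun f' h' => TensorProduct.map (LinearMap.mulLeft k f) (LinearMap.mulRight k h')
        (cross hS h f'))
      (fun a b h' => by simp)
      (fun c a h' => by simp)
      (fun a h' h'' => by
        rw [← LinearMap.add_apply, ← TensorProduct.map_add_right]; congr; ext; simp [mul_add])
      (fun c a h' => by
        rw [← LinearMap.smul_apply, ← TensorProduct.map_smul_right]; congr; ext; simp))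
    (fun f f' h => by
      ext a b
      simp only [TensorProduct.AlgebraTensorModule.curry_apply, LinearMap.restrictScalars_self,
        TensorProduct.curry_apply, TensorProduct.lift.tmul, LinearMap.mk₂_apply,
        LinearMap.add_apply]
      rw [← LinearMap.add_apply, ← TensorProduct.map_add_left]; congr; ext; simp [add_mul])
    (fun c f h => by
      ext a b
      simp only [TensorProduct.AlgebraTensorModule.curry_apply, LinearMap.restrictScalars_self,
        TensorProduct.curry_apply, TensorProduct.lift.tmul, LinearMap.mk₂_apply,
        LinearMap.smul_apply]
      rw [← LinearMap.smul_apply, ← TensorProduct.map_smul_left]; congr; ext; simp)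
    (fun f h h' => by ext a b; simp)
    (fun c f h => by ext a b; simp)

lemma mulMap_tmul (f f' : HopfDual k H) (h h' : H) :
    mulMap hS (f ⊗ₜ h) (f' ⊗ₜ h') =
      TensorProduct.map (LinearMap.mulLeft k f) (LinearMap.mulRight k h') (cross hS h f') := rfl

instance : Mul (DrinfeldDouble k H hS) :=
  ⟨fun x y => (toTensor hS).symm (mulMap hS (toTensor hS x) (toTensor hS y))⟩

instance : One (DrinfeldDouble k H hS) := ⟨mk hS 1 1⟩

lemma toTensor_mul (x y : DrinfeldDouble k H hS) :
    toTensor hS (x * y) = mulMap hS (toTensor hS x) (toTensor hS y) := rfl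

lemma toTensor_one : toTensor hS (1 : DrinfeldDouble k H hS) = 1 ⊗ₜ 1 := rfl

/-- The multiplication of `D(H)` in Sweedler form. -/
lemma mk_mul_mk (f f' : HopfDual k H) (h h' : H) :
    mk hS f h * mk hS f' h' = ∑ i ∈ (ℛ k h).index, ∑ j ∈ (ℛ k ((ℛ k h).left i)).index,
      mk hS (f * leftHit ((ℛ k ((ℛ k h).left i)).left j)
        (rightHit (antipodeInv hS ((ℛ k h).right i)) f'))
          ((ℛ k ((ℛ k h).left i)).right j * h') := by
  apply (toTensor hS).injective
  rw [toTensor_mul]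
  simp only [mk, LinearEquiv.apply_symm_apply, mulMap_tmul, cross_apply, map_sum,
    TensorProduct.map_tmul, LinearMap.mulLeft_apply, LinearMap.mulRight_apply]

section Lift

variable {B : Type*} [Ring B] [Algebra k B]

lemma liftAux_mulMap (α : H →ₐ[k] B) (β : HopfDual k H →ₐ[k] B)
    (hc : Compatible α.toLinearMap β.toLinearMap) (x y : HopfDual k H ⊗[k] H) :
    liftAux α.toLinearMap β.toLinearMap (mulMap hS x y) =
      liftAux α.toLinearMap β.toLinearMap x * liftAux α.toLinearMap β.toLinearMap y := by
  induction x with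
  | zero => simp
  | add a b ha hb => simp only [map_add, LinearMap.add_apply, ha, hb, add_mul]
  | tmul f h =>
    induction y with
    | zero => simp
    | add a b ha hb => simp only [map_add, ha, hb, mul_add]
    | tmul f' h' =>
      have h1 : ∀ t : HopfDual k H ⊗[k] H, liftAux α.toLinearMap β.toLinearMap
          (TensorProduct.map (LinearMap.mulLeft k f) (LinearMap.mulRight k h') t) =
          β f * liftAux α.toLinearMap β.toLinearMap t * α h' := by
        intro t
        induction t with
        | zero => simp
        | add a b ha hb => simp only [map_add, ha, hb, mul_add, add_mul]
        | tmul a b => simp [mul_assoc]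
      rw [mulMap_tmul, h1, ← hc.mul_eq hS]
      simp [mul_assoc]

end Lift

lemma rep_mulMap (x y : HopfDual k H ⊗[k] H) :
    DoubleRep.rep hS (mulMap hS x y) = DoubleRep.rep hS x * DoubleRep.rep hS y :=
  liftAux_mulMap hS _ _ (DoubleRep.compatible hS) x y

lemma rep_one : DoubleRep.rep hS (1 ⊗ₜ 1) = 1 := by
  simp [DoubleRep.rep]

variable [FiniteDimensional k H]

instance : Ring (DrinfeldDouble k H hS) where
  __ := (inferInstance : AddCommGroup (DrinfeldDouble k H hS))
  __ := (inferInstance : Mul (DrinfeldDouble k H hS))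
  __ := (inferInstance : One (DrinfeldDouble k H hS))
  left_distrib x y z := by
    apply (toTensor hS).injective
    simp only [toTensor_mul, map_add]
  right_distrib x y z := by
    apply (toTensor hS).injective
    simp only [toTensor_mul, map_add, LinearMap.add_apply]
  zero_mul x := by
    apply (toTensor hS).injective
    simp only [toTensor_mul, map_zero, LinearMap.zero_apply]
  mul_zero x := by
    apply (toTensor hS).injective
    simp only [toTensor_mul, map_zero]
  mul_assoc x y z := by
    apply (toTensor hS).injective
    apply DoubleRep.rep_injective hS
    simp only [toTensor_mul, rep_mulMap, mul_assoc]
  one_mul x := by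
    apply (toTensor hS).injective
    apply DoubleRep.rep_injective hS
    simp only [toTensor_mul, rep_mulMap, toTensor_one, rep_one, one_mul]
  mul_one x := by
    apply (toTensor hS).injective
    apply DoubleRep.rep_injective hS
    simp only [toTensor_mul, rep_mulMap, toTensor_one, rep_one, mul_one]

instance : Algebra k (DrinfeldDouble k H hS) :=
  Algebra.ofModule
    (fun r x y => by
      apply (toTensor hS).injective
      simp only [toTensor_mul, map_smul, LinearMap.smul_apply])
    (fun r x y => by
      apply (toTensor hS).injective
      simp only [toTensor_mul, map_smul])

instance : FiniteDimensional k (DrinfeldDouble k H hS) :=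
  Module.Finite.equiv (toTensor hS).symm

/-- The algebra homomorphism `D(H) → B`, `f ⊗ h ↦ β(f) α(h)`, defined by compatible algebra
homomorphisms `α : H → B` and `β : H^* → B`. -/
def lift {B : Type*} [Ring B] [Algebra k B] (α : H →ₐ[k] B) (β : HopfDual k H →ₐ[k] B)
    (hc : Compatible α.toLinearMap β.toLinearMap) : DrinfeldDouble k H hS →ₐ[k] B :=
  AlgHom.ofLinearMap (liftAux α.toLinearMap β.toLinearMap ∘ₗ (toTensor hS).toLinearMap)
    (by simp [toTensor_one])
    (fun x y => liftAux_mulMap hS α β hc _ _)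

@[simp]
lemma lift_mk {B : Type*} [Ring B] [Algebra k B] (α : H →ₐ[k] B) (β : HopfDual k H →ₐ[k] B)
    (hc : Compatible α.toLinearMap β.toLinearMap) (f : HopfDual k H) (h : H) :
    lift hS α β hc (mk hS f h) = β f * α h := by
  exact liftAux_tmul _ _ f h

/-- The representation `rep` as an algebra homomorphism. -/
def repHom : DrinfeldDouble k H hS →ₐ[k] Module.End k (DoubleRep.V k H) :=
  lift hS _ _ (DoubleRep.compatible hS)

lemma repHom_injective : Function.Injective (repHom hS) :=
  (DoubleRep.rep_injective hS).comp (toTensor hS).injective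

lemma repHom_mk (f : HopfDual k H) (h : H) :
    repHom hS (mk hS f h) = DoubleRep.opF f * DoubleRep.opH hS h := by
  simp [repHom]

/-- The embedding of `H` into `D(H)`, `h ↦ 1 ⊗ h`. -/
def inclH : H →ₐ[k] DrinfeldDouble k H hS :=
  AlgHom.ofLinearMap ((toTensor hS).symm.toLinearMap ∘ₗ TensorProduct.mk k (HopfDual k H) H 1) rfl
    (fun h h' => by
      apply repHom_injective hS
      refine Eq.trans ?_ (map_mul (repHom hS) _ _).symm
      change repHom hS (mk hS 1 (h * h')) = repHom hS (mk hS 1 h) * repHom hS (mk hS 1 h')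
      rw [repHom_mk, repHom_mk, repHom_mk]
      simp)

/-- The embedding of `H^*` into `D(H)`, `f ↦ f ⊗ 1`. -/
def inclDual : HopfDual k H →ₐ[k] DrinfeldDouble k H hS :=
  AlgHom.ofLinearMap
    ((toTensor hS).symm.toLinearMap ∘ₗ (TensorProduct.mk k (HopfDual k H) H).flip 1) rfl
    (fun h h' => by
      apply repHom_injective hS
      refine Eq.trans ?_ (map_mul (repHom hS) _ _).symm
      change repHom hS (mk hS (h * h') 1) = repHom hS (mk hS h 1) * repHom hS (mk hS h' 1)
      rw [repHom_mk, repHom_mk, repHom_mk]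
      simp)

lemma inclH_apply (h : H) : inclH hS h = mk hS 1 h := rfl

lemma inclDual_apply (f : HopfDual k H) : inclDual hS f = mk hS f 1 := rfl

lemma mk_eq (f : HopfDual k H) (h : H) : mk hS f h = inclDual hS f * inclH hS h := by
  apply repHom_injective hS
  rw [inclH_apply, inclDual_apply, map_mul, repHom_mk, repHom_mk, repHom_mk]
  simp

lemma repHom_inclH (h : H) : repHom hS (inclH hS h) = DoubleRep.opH hS h := by
  rw [inclH_apply, repHom_mk]; simp

lemma repHom_inclDual (f : HopfDual k H) : repHom hS (inclDual hS f) = DoubleRep.opF f := by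
  rw [inclDual_apply, repHom_mk]; simp

@[simp]
lemma lift_inclH {B : Type*} [Ring B] [Algebra k B] (α : H →ₐ[k] B) (β : HopfDual k H →ₐ[k] B)
    (hc : Compatible α.toLinearMap β.toLinearMap) (h : H) : lift hS α β hc (inclH hS h) = α h := by
  simp [inclH_apply]

@[simp]
lemma lift_inclDual {B : Type*} [Ring B] [Algebra k B] (α : H →ₐ[k] B) (β : HopfDual k H →ₐ[k] B)
    (hc : Compatible α.toLinearMap β.toLinearMap) (f : HopfDual k H) :
    lift hS α β hc (inclDual hS f) = β f := by
  simp [inclDual_apply]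

lemma algHom_ext {B : Type*} [Semiring B] [Algebra k B] {F G : DrinfeldDouble k H hS →ₐ[k] B}
    (h₁ : ∀ h, F (inclH hS h) = G (inclH hS h))
    (h₂ : ∀ f, F (inclDual hS f) = G (inclDual hS f)) : F = G := by
  refine AlgHom.ext fun x => ?_
  induction x using induction_on with
  | zero => simp
  | mk' f h => simp only [mk_eq, map_mul, h₁, h₂]
  | add x y hx hy => simp only [map_add, hx, hy]

lemma compatible_incl :
    Compatible (inclH hS).toLinearMap (inclDual (k := k) (H := H) hS).toLinearMap := by
  refine compatible_of_sum fun f h => ?_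
  apply repHom_injective hS
  have := (DoubleRep.compatible hS).sum_eq f (ℛ k h)
  simpa [repHom_inclH, repHom_inclDual] using this

section HitComul

lemma comul_rightHit (h : H) (f : HopfDual k H) :
    comul (R := k) (rightHit h f) = TensorProduct.map (rightHit h) LinearMap.id (comul (R := k) f) := by
  refine tensor_ext fun x y => ?_
  rw [pairing_map_hit _ _ (fun x => h * x) (fun x => x) (by simp) (by simp)]
  simp [mul_assoc]

lemma comul_leftHit (h : H) (f : HopfDual k H) :
    comul (R := k) (leftHit h f) = TensorProduct.map LinearMap.id (leftHit h) (comul (R := k) f) := by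
  refine tensor_ext fun x y => ?_
  rw [pairing_map_hit _ _ (fun x => x) (fun x => x * h) (by simp) (by simp)]
  simp [mul_assoc]

lemma map_leftHit_comul (h : H) (f : HopfDual k H) :
    TensorProduct.map (leftHit h) LinearMap.id (comul (R := k) f) =
      TensorProduct.map LinearMap.id (rightHit h) (comul (R := k) f) := by
  refine tensor_ext fun x y => ?_
  rw [pairing_map_hit _ _ (fun x => x * h) (fun x => x) (by simp) (by simp),
    pairing_map_hit _ _ (fun x => x) (fun x => h * x) (by simp) (by simp)]
  simp [mul_assoc]

end HitComul

/-- The comultiplication of `D(H)` on `H`: `h ↦ ∑ h₁ ⊗ h₂`. -/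
def comulH : H →ₐ[k] DrinfeldDouble k H hS ⊗[k] DrinfeldDouble k H hS :=
  (Algebra.TensorProduct.map (inclH hS) (inclH hS)).comp (Bialgebra.comulAlgHom k H)

/-- The comultiplication of `D(H)` on `H^{*cop}`: `f ↦ ∑ f₂ ⊗ f₁`. -/
def comulDual : HopfDual k H →ₐ[k] DrinfeldDouble k H hS ⊗[k] DrinfeldDouble k H hS :=
  (Algebra.TensorProduct.map (inclDual hS) (inclDual hS)).comp
    ((Algebra.TensorProduct.comm k (HopfDual k H) (HopfDual k H)).toAlgHom.comp
      (Bialgebra.comulAlgHom k (HopfDual k H)))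

lemma comulH_apply {ι : Type*} {h : H} (r : Coalgebra.Repr k h ι) :
    comulH hS h = ∑ i ∈ r.index, inclH hS (r.left i) ⊗ₜ inclH hS (r.right i) := by
  change Algebra.TensorProduct.map (inclH hS) (inclH hS) (comul h) = _
  rw [← r.eq, map_sum]
  simp

lemma comulDual_apply {ι : Type*} {f : HopfDual k H} (r : Coalgebra.Repr k f ι) :
    comulDual hS f = ∑ i ∈ r.index, inclDual hS (r.right i) ⊗ₜ inclDual hS (r.left i) := by
  change Algebra.TensorProduct.map (inclDual hS) (inclDual hS)
    (Algebra.TensorProduct.comm k (HopfDual k H) (HopfDual k H) (comul f)) = _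
  rw [← r.eq, map_sum, map_sum]
  simp

lemma comulDual_rightHit (h : H) (f : HopfDual k H) :
    comulDual hS (rightHit h f) = ∑ i ∈ (ℛ k f).index,
      inclDual hS ((ℛ k f).right i) ⊗ₜ inclDual hS (rightHit h ((ℛ k f).left i)) := by
  change Algebra.TensorProduct.map (inclDual hS) (inclDual hS)
    (Algebra.TensorProduct.comm k (HopfDual k H) (HopfDual k H) (comul (rightHit h f))) = _
  rw [comul_rightHit, ← (ℛ k f).eq, map_sum, map_sum, map_sum]
  simp

lemma comulDual_leftHit (h : H) (f : HopfDual k H) :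
    comulDual hS (leftHit h f) = ∑ i ∈ (ℛ k f).index,
      inclDual hS (leftHit h ((ℛ k f).right i)) ⊗ₜ inclDual hS ((ℛ k f).left i) := by
  change Algebra.TensorProduct.map (inclDual hS) (inclDual hS)
    (Algebra.TensorProduct.comm k (HopfDual k H) (HopfDual k H) (comul (leftHit h f))) = _
  rw [comul_leftHit, ← (ℛ k f).eq, map_sum, map_sum, map_sum]
  simp

lemma sum_hit (h : H) (f : HopfDual k H) :
    ∑ i ∈ (ℛ k f).index,
      inclDual hS ((ℛ k f).right i) ⊗ₜ[k] inclDual hS (leftHit h ((ℛ k f).left i)) =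
    ∑ i ∈ (ℛ k f).index,
      inclDual hS (rightHit h ((ℛ k f).right i)) ⊗ₜ[k] inclDual hS ((ℛ k f).left i) := by
  have := congrArg (fun t => Algebra.TensorProduct.map (inclDual hS) (inclDual hS)
    (Algebra.TensorProduct.comm k (HopfDual k H) (HopfDual k H) t)) (map_leftHit_comul h f)
  simp only [← (ℛ k f).eq, map_sum] at this
  simpa using this

section CompatibleComul

open DoubleRep WithConv

/-- The convolution algebra in which the compatibility of the comultiplication is verified. -/
abbrev Conv := WithConv (H →ₗ[k] DrinfeldDouble k H hS ⊗[k] DrinfeldDouble k H hS)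

/-- `h ↦ h ⊗ 1`. -/
def c₁ : H →ₗ[k] DrinfeldDouble k H hS ⊗[k] DrinfeldDouble k H hS :=
  (Algebra.TensorProduct.includeLeft (S := k)).toLinearMap ∘ₗ (inclH hS).toLinearMap

/-- `h ↦ 1 ⊗ h`. -/
def c₂ : H →ₗ[k] DrinfeldDouble k H hS ⊗[k] DrinfeldDouble k H hS :=
  Algebra.TensorProduct.includeRight.toLinearMap ∘ₗ (inclH hS).toLinearMap

/-- `f ↦ f ⊗ 1`. -/
def d₁ : HopfDual k H →ₗ[k] DrinfeldDouble k H hS ⊗[k] DrinfeldDouble k H hS :=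
  (Algebra.TensorProduct.includeLeft (S := k)).toLinearMap ∘ₗ (inclDual hS).toLinearMap

/-- `f ↦ 1 ⊗ f`. -/
def d₂ : HopfDual k H →ₗ[k] DrinfeldDouble k H hS ⊗[k] DrinfeldDouble k H hS :=
  Algebra.TensorProduct.includeRight.toLinearMap ∘ₗ (inclDual hS).toLinearMap

lemma c₁_apply (h : H) : c₁ hS h = inclH hS h ⊗ₜ 1 := rfl
lemma c₂_apply (h : H) : c₂ hS h = 1 ⊗ₜ inclH hS h := rfl
lemma d₁_apply (f : HopfDual k H) : d₁ hS f = inclDual hS f ⊗ₜ 1 := rfl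
lemma d₂_apply (f : HopfDual k H) : d₂ hS f = 1 ⊗ₜ inclDual hS f := rfl

lemma compat₁ : Compatible (c₁ hS) (d₁ (k := k) (H := H) hS) :=
  (compatible_incl hS).algHom_comp _

lemma compat₂ : Compatible (c₂ hS) (d₂ (k := k) (H := H) hS) :=
  (compatible_incl hS).algHom_comp _

lemma comulH_eq : (toConv (comulH hS).toLinearMap : Conv hS) = toConv (c₁ hS) * toConv (c₂ hS) := by
  apply WithConv.ext
  refine LinearMap.ext fun h => ?_
  rw [conv_apply]
  simp [c₁_apply, c₂_apply, comulH_apply hS (ℛ k h)]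

lemma comulDual_right_eq (f : HopfDual k H) :
    (toConv ((comulDual hS).toLinearMap ∘ₗ rightHit.flip f) : Conv hS) =
      ∑ i ∈ (ℛ k f).index, const (d₁ hS ((ℛ k f).right i)) *
        toConv (d₂ hS ∘ₗ rightHit.flip ((ℛ k f).left i)) := by
  apply WithConv.ext
  refine LinearMap.ext fun h => ?_
  rw [WithConv.ofConv_sum, LinearMap.sum_apply]
  simp only [const_mul]
  simp [d₁_apply, d₂_apply, comulDual_rightHit]

lemma comulDual_left_eq (f : HopfDual k H) :
    (toConv ((comulDual hS).toLinearMap ∘ₗ leftHit.flip f) : Conv hS) =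
      ∑ i ∈ (ℛ k f).index, toConv (d₁ hS ∘ₗ leftHit.flip ((ℛ k f).right i)) *
        const (d₂ hS ((ℛ k f).left i)) := by
  apply WithConv.ext
  refine LinearMap.ext fun h => ?_
  rw [WithConv.ofConv_sum, LinearMap.sum_apply]
  simp only [mul_const]
  simp [d₁_apply, d₂_apply, comulDual_leftHit]

lemma middle_eq (f : HopfDual k H) :
    (∑ i ∈ (ℛ k f).index, const (d₁ hS ((ℛ k f).right i)) *
        toConv (d₂ hS ∘ₗ leftHit.flip ((ℛ k f).left i)) : Conv hS) =
      ∑ i ∈ (ℛ k f).index, toConv (d₁ hS ∘ₗ rightHit.flip ((ℛ k f).right i)) *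
        const (d₂ hS ((ℛ k f).left i)) := by
  apply WithConv.ext
  refine LinearMap.ext fun h => ?_
  rw [WithConv.ofConv_sum, LinearMap.sum_apply, WithConv.ofConv_sum, LinearMap.sum_apply]
  simp only [mul_const, const_mul]
  simp [d₁_apply, d₂_apply, sum_hit]

lemma commute₂ (f : HopfDual k H) :
    (toConv (c₂ hS) * const (d₁ hS f) : Conv hS) = const (d₁ hS f) * toConv (c₂ hS) :=
  commute_const _ _ fun h => by simp [c₂_apply, d₁_apply]

lemma commute₁ (f : HopfDual k H) :
    (toConv (c₁ hS) * const (d₂ hS f) : Conv hS) = const (d₂ hS f) * toConv (c₁ hS) :=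
  commute_const _ _ fun h => by simp [c₁_apply, d₂_apply]

lemma compatible_comul_aux {R ι : Type*} [Ring R] (s : Finset ι) (a₁ a₂ : R)
    (x y p₁ p₂ q₁ q₂ : ι → R) (hm : ∑ i ∈ s, x i * p₂ i = ∑ i ∈ s, q₁ i * y i)
    (h₁ : ∀ i, a₁ * q₁ i = p₁ i * a₁) (h₂ : ∀ i, a₂ * q₂ i = p₂ i * a₂)
    (hx : ∀ i, a₂ * x i = x i * a₂) (hy : ∀ i, a₁ * y i = y i * a₁) :
    a₁ * a₂ * ∑ i ∈ s, x i * q₂ i = (∑ i ∈ s, p₁ i * y i) * (a₁ * a₂) := by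
  calc a₁ * a₂ * ∑ i ∈ s, x i * q₂ i = a₁ * (∑ i ∈ s, x i * p₂ i) * a₂ := by
        simp only [Finset.mul_sum, Finset.sum_mul]
        refine Finset.sum_congr rfl fun i _ => ?_
        rw [mul_assoc, ← mul_assoc a₂, hx, mul_assoc (x i), h₂]
        simp only [mul_assoc]
    _ = a₁ * (∑ i ∈ s, q₁ i * y i) * a₂ := by rw [hm]
    _ = _ := by
        simp only [Finset.mul_sum, Finset.sum_mul]
        refine Finset.sum_congr rfl fun i _ => ?_
        rw [← mul_assoc a₁, h₁, mul_assoc (p₁ i), hy]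
        simp only [mul_assoc]

lemma compatible_comul : Compatible (comulH hS).toLinearMap (comulDual hS).toLinearMap := by
  intro f
  rw [comulH_eq, comulDual_right_eq, comulDual_left_eq]
  exact compatible_comul_aux _ _ _ _ _ _ _ _ _ (middle_eq hS f) (fun i => compat₁ hS _)
    (fun i => compat₂ hS _) (fun i => commute₂ hS _) (fun i => commute₁ hS _)

end CompatibleComul

/-- The comultiplication of `D(H)`: `Δ(f ⊗ h) = ∑ (f₂ ⊗ h₁) ⊗ (f₁ ⊗ h₂)`. -/
def comulHom :
    DrinfeldDouble k H hS →ₐ[k] DrinfeldDouble k H hS ⊗[k] DrinfeldDouble k H hS :=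
  lift hS (comulH hS) (comulDual hS) (compatible_comul hS)

lemma compatible_counit : Compatible (Bialgebra.counitAlgHom k H).toLinearMap
    (Bialgebra.counitAlgHom k (HopfDual k H)).toLinearMap := by
  refine compatible_of_sum fun f h => ?_
  have h1 := congrArg (TensorProduct.lid k H) (sum_counit_tmul_eq (ℛ k h))
  have h2 := congrArg (TensorProduct.rid k H) (sum_tmul_counit_eq (ℛ k h))
  simp only [map_sum, lid_tmul, rid_tmul, one_smul] at h1 h2
  have h3 := congrArg (toDual k H f) (h1.trans h2.symm)
  simpa [HopfDual.counit_apply, mul_comm] using h3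

/-- The counit of `D(H)`: `ε(f ⊗ h) = f(1) ε(h)`. -/
def counitHom : DrinfeldDouble k H hS →ₐ[k] k :=
  lift hS (Bialgebra.counitAlgHom k H) (Bialgebra.counitAlgHom k (HopfDual k H)) compatible_counit

lemma comulHom_inclH {ι : Type*} {h : H} (r : Coalgebra.Repr k h ι) :
    comulHom hS (inclH hS h) = ∑ i ∈ r.index, inclH hS (r.left i) ⊗ₜ inclH hS (r.right i) :=
  (lift_inclH ..).trans (comulH_apply hS r)

lemma comulHom_inclDual {ι : Type*} {f : HopfDual k H} (r : Coalgebra.Repr k f ι) :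
    comulHom hS (inclDual hS f) =
      ∑ i ∈ r.index, inclDual hS (r.right i) ⊗ₜ inclDual hS (r.left i) :=
  (lift_inclDual ..).trans (comulDual_apply hS r)

lemma counitHom_inclH (h : H) : counitHom hS (inclH hS h) = counit (R := k) h :=
  lift_inclH ..

lemma counitHom_inclDual (f : HopfDual k H) : counitHom hS (inclDual hS f) = f 1 :=
  lift_inclDual ..

instance : Bialgebra k (DrinfeldDouble k H hS) :=
  Bialgebra.ofAlgHom (comulHom hS) (counitHom hS)
    (by
      refine algHom_ext hS (fun h => ?_) (fun f => ?_)
      · have key := congrArg (TensorProduct.map (inclH hS).toLinearMap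
          (TensorProduct.map (inclH hS).toLinearMap (inclH hS).toLinearMap))
          (sum_tmul_tmul_eq (ℛ k h) (fun i => ℛ k ((ℛ k h).left i))
            (fun i => ℛ k ((ℛ k h).right i)))
        simp only [map_sum, TensorProduct.map_tmul, AlgHom.toLinearMap_apply] at key
        simp only [AlgHom.comp_apply, comulHom_inclH hS (ℛ k h), map_sum,
          Algebra.TensorProduct.map_tmul, AlgHom.id_apply]
        simp only [comulHom_inclH hS (ℛ k ((ℛ k h).left _)),
          comulHom_inclH hS (ℛ k ((ℛ k h).right _)), sum_tmul, tmul_sum, map_sum]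
        exact key
      · have key := congrArg (TensorProduct.map (inclDual hS).toLinearMap
          (TensorProduct.map (inclDual hS).toLinearMap (inclDual hS).toLinearMap) ∘
          (TensorProduct.leftComm k _ _ _) ∘
          (TensorProduct.map LinearMap.id (TensorProduct.comm k _ _).toLinearMap) ∘
          (TensorProduct.leftComm k _ _ _))
          (sum_tmul_tmul_eq (ℛ k f) (fun i => ℛ k ((ℛ k f).left i))
            (fun i => ℛ k ((ℛ k f).right i)))
        simp only [Function.comp_apply, map_sum, TensorProduct.map_tmul,
          AlgHom.toLinearMap_apply, TensorProduct.leftComm_tmul, LinearMap.id_apply,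
          LinearEquiv.coe_coe, TensorProduct.comm_tmul] at key
        simp only [AlgHom.comp_apply, comulHom_inclDual hS (ℛ k f), map_sum,
          Algebra.TensorProduct.map_tmul, AlgHom.id_apply]
        simp only [comulHom_inclDual hS (ℛ k ((ℛ k f).left _)),
          comulHom_inclDual hS (ℛ k ((ℛ k f).right _)), sum_tmul, tmul_sum, map_sum]
        exact key.symm)
    (by
      refine algHom_ext hS (fun h => ?_) (fun f => ?_)
      · apply (TensorProduct.lid k _).injective
        have h1 := congrArg (TensorProduct.lid k H) (sum_counit_tmul_eq (ℛ k h))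
        simp only [map_sum, lid_tmul, one_smul] at h1
        simp only [AlgHom.comp_apply, comulHom_inclH hS (ℛ k h), map_sum,
          Algebra.TensorProduct.map_tmul, AlgHom.id_apply, counitHom_inclH, lid_tmul]
        simpa using congrArg (inclH hS) h1
      · apply (TensorProduct.lid k _).injective
        have h1 := congrArg (TensorProduct.rid k _) (sum_tmul_counit_eq (ℛ k f))
        simp only [map_sum, rid_tmul, one_smul, HopfDual.counit_apply] at h1
        simp only [AlgHom.comp_apply, comulHom_inclDual hS (ℛ k f), map_sum,
          Algebra.TensorProduct.map_tmul, AlgHom.id_apply, counitHom_inclDual, lid_tmul]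
        simpa using congrArg (inclDual hS) h1)
    (by
      refine algHom_ext hS (fun h => ?_) (fun f => ?_)
      · apply (TensorProduct.rid k _).injective
        have h1 := congrArg (TensorProduct.rid k H) (sum_tmul_counit_eq (ℛ k h))
        simp only [map_sum, rid_tmul, one_smul] at h1
        simp only [AlgHom.comp_apply, comulHom_inclH hS (ℛ k h), map_sum,
          Algebra.TensorProduct.map_tmul, AlgHom.id_apply, counitHom_inclH, rid_tmul]
        simpa using congrArg (inclH hS) h1
      · apply (TensorProduct.rid k _).injective
        have h1 := congrArg (TensorProduct.lid k _) (sum_counit_tmul_eq (ℛ k f))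
        simp only [map_sum, lid_tmul, one_smul, HopfDual.counit_apply] at h1
        simp only [AlgHom.comp_apply, comulHom_inclDual hS (ℛ k f), map_sum,
          Algebra.TensorProduct.map_tmul, AlgHom.id_apply, counitHom_inclDual, rid_tmul]
        simpa using congrArg (inclDual hS) h1)

/-- `Δ(f ⊗ h) = ∑ (f₂ ⊗ h₁) ⊗ (f₁ ⊗ h₂)`: the coalgebra `D(H)` is `H^{*cop} ⊗ H`. -/
lemma comul_mk {ι κ : Type*} {f : HopfDual k H} {h : H} (r : Coalgebra.Repr k f ι)
    (s : Coalgebra.Repr k h κ) :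
    comul (R := k) (mk hS f h) = ∑ i ∈ r.index, ∑ j ∈ s.index,
      mk hS (r.right i) (s.left j) ⊗ₜ[k] mk hS (r.left i) (s.right j) := by
  change comulHom hS (mk hS f h) = _
  simp only [mk_eq, map_mul, comulHom_inclH hS s, comulHom_inclDual hS r, Finset.sum_mul_sum,
    Algebra.TensorProduct.tmul_mul_tmul]

lemma counit_mk (f : HopfDual k H) (h : H) :
    counit (R := k) (mk hS f h) = f 1 * counit (R := k) h := by
  change counitHom hS (mk hS f h) = _
  rw [mk_eq, map_mul, counitHom_inclH, counitHom_inclDual]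

lemma sum_dualAntipodeInv_mul {ι : Type*} {f : HopfDual k H} (r : Coalgebra.Repr k f ι) :
    ∑ i ∈ r.index, dualAntipodeInv hS (r.right i) * r.left i = algebraMap k _ (f 1) := by
  refine ext' fun x => ?_
  have h' := congrArg (toDual k H f) (sum_mul_antipodeInv hS (ℛ k x))
  simp only [map_sum, ← sum_comul r] at h'
  rw [Finset.sum_comm] at h'
  simp only [map_sum, LinearMap.sum_apply, mul_apply _ _ (ℛ k x)]
  simpa [Algebra.algebraMap_eq_smul_one, mul_comm] using h'

lemma sum_mul_dualAntipodeInv {ι : Type*} {f : HopfDual k H} (r : Coalgebra.Repr k f ι) :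
    ∑ i ∈ r.index, r.right i * dualAntipodeInv hS (r.left i) = algebraMap k _ (f 1) := by
  refine ext' fun x => ?_
  have h' := congrArg (toDual k H f) (sum_antipodeInv_mul hS (ℛ k x))
  simp only [map_sum, ← sum_comul r] at h'
  rw [Finset.sum_comm] at h'
  simp only [map_sum, LinearMap.sum_apply, mul_apply _ _ (ℛ k x)]
  simpa [Algebra.algebraMap_eq_smul_one, mul_comm] using h'

/-- The antipode of `D(H)`: `S(f ⊗ h) = (1 ⊗ S(h)) (f ∘ S⁻¹ ⊗ 1)`. -/
def antipodeMap : DrinfeldDouble k H hS →ₗ[k] DrinfeldDouble k H hS :=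
  LinearMap.mul' k _ ∘ₗ TensorProduct.map ((inclH hS).toLinearMap ∘ₗ antipode k)
    ((inclDual hS).toLinearMap ∘ₗ dualAntipodeInv hS) ∘ₗ
    (TensorProduct.comm k _ _).toLinearMap ∘ₗ (toTensor hS).toLinearMap

lemma antipodeMap_mk (f : HopfDual k H) (h : H) : antipodeMap hS (mk hS f h) =
    inclH hS (antipode k h) * inclDual hS (dualAntipodeInv hS f) := by
  simp [antipodeMap, mk]

instance : HopfAlgebra k (DrinfeldDouble k H hS) where
  antipode := antipodeMap hS
  mul_antipode_rTensor_comul := by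
    refine LinearMap.ext fun x => ?_
    induction x using induction_on with
    | zero => simp only [map_zero]
    | add x y hx hy => simp only [map_add, hx, hy]
    | mk' f h =>
      simp only [LinearMap.comp_apply, comul_mk hS (ℛ k f) (ℛ k h), counit_mk, map_sum,
        LinearMap.rTensor_tmul, LinearMap.mul'_apply, antipodeMap_mk]
      simp only [mk_eq]
      have h1 := congrArg (inclDual hS) (sum_dualAntipodeInv_mul hS (ℛ k f))
      have h2 := congrArg (inclH hS) (sum_antipode_mul_eq_algebraMap_counit (ℛ k h))
      simp only [map_sum, map_mul, AlgHom.commutes] at h1 h2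
      rw [Finset.sum_comm]
      trans ∑ j ∈ (ℛ k h).index, inclH hS (antipode k ((ℛ k h).left j)) *
        (∑ i ∈ (ℛ k f).index, inclDual hS (dualAntipodeInv hS ((ℛ k f).right i)) *
          inclDual hS ((ℛ k f).left i)) * inclH hS ((ℛ k h).right j)
      · simp only [Finset.mul_sum, Finset.sum_mul, mul_assoc]
      · rw [h1]
        simp only [← Algebra.commutes, mul_assoc]
        rw [← Finset.mul_sum, h2]
        simp
  mul_antipode_lTensor_comul := by
    refine LinearMap.ext fun x => ?_
    induction x using induction_on with
    | zero => simp only [map_zero]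
    | add x y hx hy => simp only [map_add, hx, hy]
    | mk' f h =>
      simp only [LinearMap.comp_apply, comul_mk hS (ℛ k f) (ℛ k h), counit_mk, map_sum,
        LinearMap.lTensor_tmul, LinearMap.mul'_apply, antipodeMap_mk]
      simp only [mk_eq]
      have h1 := congrArg (inclDual hS) (sum_mul_dualAntipodeInv hS (ℛ k f))
      have h2 := congrArg (inclH hS) (sum_mul_antipode_eq_algebraMap_counit (ℛ k h))
      simp only [map_sum, map_mul, AlgHom.commutes] at h1 h2
      trans ∑ i ∈ (ℛ k f).index, inclDual hS ((ℛ k f).right i) *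
        (∑ j ∈ (ℛ k h).index, inclH hS ((ℛ k h).left j) *
          inclH hS (antipode k ((ℛ k h).right j))) *
            inclDual hS (dualAntipodeInv hS ((ℛ k f).left i))
      · simp only [Finset.mul_sum, Finset.sum_mul, mul_assoc]
      · rw [h2]
        simp only [← Algebra.commutes, mul_assoc]
        rw [← Finset.mul_sum, h1]
        simp [mul_comm]

end DrinfeldDouble
end Double

end QuantumPermutation

end

/-!
A Hopf algebra is a quotient of `𝒜_s(n)` exactly when it is generated as an algebra by the entries
of an `n × n` magic matrix `x` with `Δ (x i j) = ∑ l, x i l ⊗ x l j` and `ε (x i j) = δ i j`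
(`IsQuotientOfMagic.exists_corep`, `IsMagicCorep.isQuotientOfMagic`). Such matrices, here called
magic corepresentations, can be placed on the diagonal of a block matrix: the zero blocks spoil
neither orthogonality nor the row and column sums.

The double `D(H)` is generated by `H` and `H^{*cop}`. If `x` and `y` are generating magic
corepresentations of `H` and `H^*`, then the transpose of `y` is one of `H^{*cop}`, so `diag(x, yᵗ)`
is a generating magic corepresentation of `D(H)`, of size `d(H) + d(H^*)` when `x` and `y` have
minimal size (`isQuotientOfMagic_drinfeldDouble`).

For a finite group `G` of order `N`, the coordinate forms give the generating magic corepresentation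
`δ_{g⁻¹h}` of `(kG)^*`, of size `N`. For `kG`, each `g` satisfies `g ^ N = 1`, so the discrete
Fourier transform over `ℤ/N` of the powers of `g` is a partition of unity by orthogonal idempotents
`p a` with `Δ (p a) = ∑_{b + c = a} p b ⊗ p c`, and `(p (b - a))_{a, b}` is a magic corepresentation
of size `N` whose entries span the powers of `g`. Placing these blocks on a diagonal for all `g`
yields a generating magic corepresentation of `kG` of size `N²`. The Fourier transform needs a
primitive `N`-th root of unity in `k` and `N ≠ 0` in `k`.
-/

noncomputable section

namespace QuantumPermutation

open TensorProduct Coalgebra HopfAlgebra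

universe u v

/-! ### Magic corepresentations -/

section Corepresentation

variable (k : Type u) [Field k] {H : Type v} [Ring H] [Bialgebra k H]

/-- A magic matrix `x` over a bialgebra, indexed by an arbitrary finite type, that is also a
corepresentation: `Δ (x i j) = ∑ l, x i l ⊗ x l j` and `ε (x i j) = δ i j`. For the index type
`Fin n` these are the images of `(u i j)` under the bialgebra morphisms from `𝒜_s(n)`. -/
structure IsMagicCorep {ι : Type*} [Fintype ι] [DecidableEq ι] (x : ι → ι → H) : Prop where
  row_mul (i j l : ι) : x i j * x i l = if j = l then x i j else 0
  col_mul (i j l : ι) : x i j * x l j = if i = l then x i j else 0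
  row_sum (i : ι) : ∑ l, x i l = 1
  col_sum (i : ι) : ∑ l, x l i = 1
  comul (i j : ι) : comul (R := k) (x i j) = ∑ l, x i l ⊗ₜ[k] x l j
  counit (i j : ι) : counit (R := k) (x i j) = if i = j then 1 else 0

variable {k}

lemma IsMagicCorep.reindex {ι κ : Type*} [Fintype ι] [DecidableEq ι] [Fintype κ] [DecidableEq κ]
    {x : ι → ι → H} (hx : IsMagicCorep k x) (e : κ ≃ ι) :
    IsMagicCorep k fun i j => x (e i) (e j) where
  row_mul i j l := by simp [hx.row_mul]
  col_mul i j l := by simp [hx.col_mul]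
  row_sum i := by rw [e.sum_comp (fun l => x (e i) l), hx.row_sum]
  col_sum i := by rw [e.sum_comp (fun l => x l (e i)), hx.col_sum]
  comul i j := by rw [hx.comul, ← e.sum_comp]
  counit i j := by simp [hx.counit]

lemma IsMagicCorep.blockDiagonal {κ ι : Type*} [Fintype κ] [DecidableEq κ] [Fintype ι]
    [DecidableEq ι] {x : κ → ι → ι → H} (hx : ∀ g, IsMagicCorep k (x g)) :
    IsMagicCorep k fun i j : κ × ι => if i.1 = j.1 then x i.1 i.2 j.2 else 0 where
  row_mul := by
    rintro ⟨g, i⟩ ⟨h, j⟩ ⟨h', l⟩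
    by_cases h1 : g = h
    · subst h1
      by_cases h2 : g = h' <;> simp [h2, (hx _).row_mul]
    · simp [h1]
  col_mul := by
    rintro ⟨g, i⟩ ⟨h, j⟩ ⟨g', l⟩
    by_cases h1 : g = h
    · subst h1
      by_cases h2 : g = g'
      · subst h2; simp [(hx _).col_mul]
      · simp [h2, Ne.symm h2]
    · simp [h1]
  row_sum i := by simp [Fintype.sum_prod_type, Finset.sum_ite_irrel, (hx _).row_sum]
  col_sum i := by
    rw [Fintype.sum_prod_type, Finset.sum_eq_single i.1] <;> simp +contextual [(hx _).col_sum]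
  comul := by
    rintro ⟨g, i⟩ ⟨h, j⟩
    rw [Fintype.sum_prod_type, Finset.sum_eq_single g]
    · by_cases h1 : g = h
      · simp [h1, (hx _).comul]
      · simp [h1]
    · intro b _ hb
      simp [hb.symm]
    · simp
  counit := by
    rintro ⟨g, i⟩ ⟨h, j⟩
    by_cases h1 : g = h <;> simp [h1, (hx _).counit]

end Corepresentation

section Quotient

variable {k : Type u} [Field k] {H : Type v} [Ring H] [HopfAlgebra k H]

/-- The images of the generators `u i j` form a magic corepresentation that generates `H`; the
converse is `IsMagicCorep.isQuotientOfMagic`. -/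
lemma IsQuotientOfMagic.exists_corep {n : ℕ} (h : IsQuotientOfMagic k H n) :
    ∃ x : Fin n → Fin n → H, IsMagicCorep k x ∧
      Algebra.adjoin k (Set.range fun p : Fin n × Fin n => x p.1 p.2) = ⊤ := by
  obtain ⟨f, hf⟩ := h
  have hg := MagicAlgebra.isMagic_gen k (n := n)
  refine ⟨fun i j => f (MagicAlgebra.gen k i j), ⟨?_, ?_, ?_, ?_, ?_, ?_⟩, ?_⟩
  · intro i j l
    rw [← map_mul, hg.row_mul, apply_ite f, map_zero]
  · intro i j l
    rw [← map_mul, hg.col_mul, apply_ite f, map_zero]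
  · intro i
    rw [← map_sum, hg.row_sum, map_one]
  · intro i
    rw [← map_sum, hg.col_sum, map_one]
  · intro i j
    rw [← CoalgHomClass.map_comp_comul_apply, MagicAlgebra.comul_gen]
    simp
  · intro i j
    rw [CoalgHomClass.counit_comp_apply, MagicAlgebra.counit_gen]
  · have := congrArg (Subalgebra.map (f : MagicAlgebra k n →ₐ[k] H))
      (MagicAlgebra.adjoin_gen (k := k) (n := n))
    rw [AlgHom.map_adjoin, Algebra.map_top, ← Set.range_comp,
      (AlgHom.range_eq_top _).2 hf] at this
    exact this

lemma IsMagicCorep.isQuotientOfMagic {ι : Type*} [Fintype ι] [DecidableEq ι] {x : ι → ι → H}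
    (hx : IsMagicCorep k x) (ha : Algebra.adjoin k (Set.range fun p : ι × ι => x p.1 p.2) = ⊤) :
    IsQuotientOfMagic k H (Fintype.card ι) := by
  let e := (Fintype.equivFin ι).symm
  have hy := hx.reindex e
  have hm : IsMagic fun i j => x (e i) (e j) := ⟨hy.row_mul, hy.col_mul, hy.row_sum, hy.col_sum⟩
  refine ⟨BialgHom.ofAlgHom (MagicAlgebra.lift (k := k) _ hm) ?_ ?_, ?_⟩
  · refine MagicAlgebra.algHom_ext fun i j => ?_
    simp [hx.counit]
  · refine MagicAlgebra.algHom_ext fun i j => ?_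
    simp [hy.comul]
  · change Function.Surjective (MagicAlgebra.lift (k := k) _ hm)
    rw [← AlgHom.range_eq_top, eq_top_iff, ← ha, Algebra.adjoin_le_iff]
    rintro _ ⟨p, rfl⟩
    exact ⟨MagicAlgebra.gen k (e.symm p.1) (e.symm p.2), by simp⟩

lemma IsQuotientOfMagic.isQuantumPermutationAlgebra_and_degree_le {n : ℕ} (hn : 1 ≤ n)
    (h : IsQuotientOfMagic k H n) : IsQuantumPermutationAlgebra k H ∧ degree k H ≤ n :=
  ⟨⟨n, hn, h⟩, Nat.sInf_le ⟨hn, h⟩⟩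

lemma IsQuantumPermutationAlgebra.degree_spec (h : IsQuantumPermutationAlgebra k H) :
    1 ≤ degree k H ∧ IsQuotientOfMagic k H (degree k H) :=
  Nat.sInf_mem (s := {n : ℕ | 1 ≤ n ∧ IsQuotientOfMagic k H n}) h

end Quotient

/-! ### Corepresentations of the Drinfeld double -/

section Double

variable {k : Type u} [Field k] {H : Type v} [Ring H] [HopfAlgebra k H] [FiniteDimensional k H]
  (hS : Function.Bijective (antipode k : H →ₗ[k] H))

open DrinfeldDouble

/-- The matrix `diag(x, yᵗ)` over `D(H)`. -/
def doubleMatrix {ι κ : Type*} (x : ι → ι → H) (y : κ → κ → HopfDual k H) :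
    ι ⊕ κ → ι ⊕ κ → DrinfeldDouble k H hS
  | .inl i, .inl j => inclH hS (x i j)
  | .inr i, .inr j => inclDual hS (y j i)
  | .inl _, .inr _ => 0
  | .inr _, .inl _ => 0

variable {ι κ : Type*} {x : ι → ι → H} {y : κ → κ → HopfDual k H}

/-- The transpose of `y` is needed because `D(H)` contains `H^*` with the opposite
comultiplication. -/
lemma isMagicCorep_doubleMatrix [Fintype ι] [DecidableEq ι] [Fintype κ] [DecidableEq κ]
    (hx : IsMagicCorep k x) (hy : IsMagicCorep k y) :
    IsMagicCorep k (doubleMatrix hS x y) where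
  row_mul := by
    rintro (i | i) (j | j) (l | l) <;>
      simp [doubleMatrix, ← map_mul, hx.row_mul, hy.col_mul, apply_ite (inclH hS),
        apply_ite (inclDual hS)]
  col_mul := by
    rintro (i | i) (j | j) (l | l) <;>
      simp [doubleMatrix, ← map_mul, hx.col_mul, hy.row_mul, apply_ite (inclH hS),
        apply_ite (inclDual hS)]
  row_sum := by
    rintro (i | i) <;> simp [doubleMatrix, ← map_sum, hx.row_sum, hy.col_sum]
  col_sum := by
    rintro (i | i) <;> simp [doubleMatrix, ← map_sum, hx.col_sum, hy.row_sum]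
  comul := by
    rintro (i | i) (j | j)
    · change comulHom hS (inclH hS (x i j)) = _
      rw [comulHom_inclH hS ⟨Finset.univ, x i, (x · j), (hx.comul i j).symm⟩]
      simp [doubleMatrix]
    · simp [doubleMatrix]
    · simp [doubleMatrix]
    · change comulHom hS (inclDual hS (y j i)) = _
      rw [comulHom_inclDual hS ⟨Finset.univ, y j, (y · i), (hy.comul j i).symm⟩]
      simp [doubleMatrix]
  counit := by
    rintro (i | i) (j | j)
    · exact (counitHom_inclH hS (x i j)).trans (by simp [hx.counit])
    · simp [doubleMatrix]
    · simp [doubleMatrix]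
    · exact (counitHom_inclDual hS (y j i)).trans
        ((hy.counit j i).trans (by simp [eq_comm]))

/-- `D(H)` is generated by the copies of `H` and `H^*`. -/
lemma adjoin_doubleMatrix
    (hx : Algebra.adjoin k (Set.range fun p : ι × ι => x p.1 p.2) = ⊤)
    (hy : Algebra.adjoin k (Set.range fun p : κ × κ => y p.1 p.2) = ⊤) :
    Algebra.adjoin k
      (Set.range fun p : (ι ⊕ κ) × (ι ⊕ κ) => doubleMatrix hS x y p.1 p.2) = ⊤ := by
  set A := Algebra.adjoin k
      (Set.range fun p : (ι ⊕ κ) × (ι ⊕ κ) => doubleMatrix hS x y p.1 p.2)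
  have h1 : (⊤ : Subalgebra k H) ≤ A.comap (inclH hS) := by
    rw [← hx, Algebra.adjoin_le_iff]
    rintro _ ⟨p, rfl⟩
    exact Algebra.subset_adjoin ⟨(.inl p.1, .inl p.2), rfl⟩
  have h2 : (⊤ : Subalgebra k (HopfDual k H)) ≤ A.comap (inclDual hS) := by
    rw [← hy, Algebra.adjoin_le_iff]
    rintro _ ⟨p, rfl⟩
    exact Algebra.subset_adjoin ⟨(.inr p.2, .inr p.1), rfl⟩
  rw [eq_top_iff]
  rintro z -
  induction z using DrinfeldDouble.induction_on with
  | zero => exact A.zero_mem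
  | mk' f h =>
    rw [mk_eq]
    exact A.mul_mem (h2 (x := f) trivial) (h1 (x := h) trivial)
  | add a b ha hb => exact A.add_mem ha hb

lemma isQuotientOfMagic_drinfeldDouble [Fintype ι] [DecidableEq ι] [Fintype κ] [DecidableEq κ]
    (hx : IsMagicCorep k x) (hy : IsMagicCorep k y)
    (hx' : Algebra.adjoin k (Set.range fun p : ι × ι => x p.1 p.2) = ⊤)
    (hy' : Algebra.adjoin k (Set.range fun p : κ × κ => y p.1 p.2) = ⊤) :
    IsQuotientOfMagic k (DrinfeldDouble k H hS) (Fintype.card ι + Fintype.card κ) := by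
  rw [← Fintype.card_sum]
  exact (isMagicCorep_doubleMatrix hS hx hy).isQuotientOfMagic (adjoin_doubleMatrix hS hx' hy')

end Double

/-! ### Fourier transform of cyclic families of group-like elements -/

section Fourier

variable {k : Type u} [Field k] [CharZero k] {A : Type v} [Ring A] {N : ℕ} [NeZero N]

/-- The Fourier transform `a ↦ N⁻¹ ∑ l, ψ(l a) γ(l)` of a homomorphism `γ` from `ℤ/N` to the
multiplicative monoid of `A`. -/
def fourierIdempotent [Algebra k A] (ψ : AddChar (ZMod N) k) (γ : AddChar (ZMod N) A)
    (a : ZMod N) : A :=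
  (N : k)⁻¹ • ∑ l, ψ (l * a) • γ l

variable {ψ : AddChar (ZMod N) k}

lemma sum_char_mul (hψ : ψ.IsPrimitive) (b : ZMod N) :
    ∑ l, ψ (l * b) = if b = 0 then (N : k) else 0 := by
  rw [AddChar.sum_mulShift b hψ]
  split_ifs <;> simp

section Algebra

variable [Algebra k A] (hψ : ψ.IsPrimitive) (γ : AddChar (ZMod N) A)

include hψ

/-- Orthogonality of the characters makes the Fourier coefficients orthogonal idempotents. -/
lemma fourierIdempotent_mul (a b : ZMod N) :
    fourierIdempotent ψ γ a * fourierIdempotent ψ γ b =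
      if a = b then fourierIdempotent ψ γ a else 0 := by
  have hN : (N : k) ≠ 0 := NeZero.ne _
  have key : (∑ l, ψ (l * a) • γ l) * (∑ l, ψ (l * b) • γ l) =
      (if b - a = 0 then (N : k) else 0) • ∑ l, ψ (l * a) • γ l := by
    rw [← sum_char_mul hψ, Finset.sum_mul_sum, Finset.sum_comm, Finset.sum_smul]
    refine Finset.sum_congr rfl fun m _ => ?_
    -- substitute `l = s - m` in the inner sum, so that `ψ (l a + m b) = ψ (s a) ψ (m (b - a))`
    rw [← (Equiv.subRight m).sum_comp, Finset.smul_sum]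
    refine Finset.sum_congr rfl fun s _ => ?_
    rw [Equiv.subRight_apply, smul_mul_smul_comm, ← AddChar.map_add_eq_mul,
      ← AddChar.map_add_eq_mul, smul_smul, ← AddChar.map_add_eq_mul]
    congr 2 <;> ring
  rw [fourierIdempotent, fourierIdempotent, smul_mul_smul_comm, key, smul_smul]
  by_cases h : a = b
  · simp [h, hN]
  · simp [h, sub_eq_zero, Ne.symm h]

/-- Fourier inversion. -/
lemma sum_char_smul_fourierIdempotent (m : ZMod N) :
    ∑ a, ψ (-m * a) • fourierIdempotent ψ γ a = γ m := by
  have hN : (N : k) ≠ 0 := NeZero.ne _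
  have key (a : ZMod N) : ψ (-m * a) • fourierIdempotent ψ γ a =
      ∑ l, ((N : k)⁻¹ * ψ (a * (l - m))) • γ l := by
    rw [fourierIdempotent, Finset.smul_sum, Finset.smul_sum]
    refine Finset.sum_congr rfl fun l _ => ?_
    rw [smul_smul, smul_smul, mul_comm (ψ _), mul_assoc, ← AddChar.map_add_eq_mul]
    congr 3; ring
  simp_rw [key]
  rw [Finset.sum_comm]
  simp_rw [← Finset.sum_smul, ← Finset.mul_sum, sum_char_mul hψ, sub_eq_zero]
  simp [hN]

lemma sum_fourierIdempotent : ∑ a, fourierIdempotent ψ γ a = 1 := by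
  simpa using sum_char_smul_fourierIdempotent hψ γ 0

end Algebra

/-- If `γ` consists of group-like elements, its Fourier transform spans a copy of a quotient of the
function algebra of `ℤ/N`, whence a circulant magic corepresentation. -/
lemma isMagicCorep_fourierIdempotent [Bialgebra k A] (hψ : ψ.IsPrimitive)
    (γ : AddChar (ZMod N) A)
    (hc : ∀ l, comul (R := k) (γ l) = γ l ⊗ₜ γ l) (hε : ∀ l, counit (R := k) (γ l) = 1) :
    IsMagicCorep k fun a b => fourierIdempotent ψ γ (b - a) where
  row_mul i j l := by simp [fourierIdempotent_mul hψ]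
  col_mul i j l := by simp [fourierIdempotent_mul hψ]
  row_sum i := by
    exact ((Equiv.subRight i).sum_comp (fourierIdempotent ψ γ)).trans (sum_fourierIdempotent hψ γ)
  col_sum i := by
    exact ((Equiv.subLeft i).sum_comp (fourierIdempotent ψ γ)).trans (sum_fourierIdempotent hψ γ)
  comul a b := by
    have hN : (N : k) ≠ 0 := NeZero.ne _
    have key (c : ZMod N) : fourierIdempotent ψ γ (c - a) ⊗ₜ[k] fourierIdempotent ψ γ (b - c) =
        ∑ m, ∑ l, ((N : k)⁻¹ * (N : k)⁻¹ * ψ (m * b - l * a) * ψ (c * (l - m))) •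
          (γ l ⊗ₜ[k] γ m) := by
      simp only [fourierIdempotent, smul_tmul_smul, sum_tmul, tmul_sum, Finset.smul_sum]
      refine Finset.sum_congr rfl fun m _ => Finset.sum_congr rfl fun l _ => ?_
      rw [smul_smul, mul_assoc _ (ψ _) (ψ _), ← AddChar.map_add_eq_mul, ← AddChar.map_add_eq_mul]
      congr 3; ring
    simp_rw [key]
    rw [Finset.sum_comm]
    simp only [fourierIdempotent, map_smul, map_sum, hc, Finset.smul_sum]
    refine Finset.sum_congr rfl fun m _ => ?_
    rw [Finset.sum_comm]
    simp_rw [← Finset.sum_smul, ← Finset.mul_sum, sum_char_mul hψ, sub_eq_zero]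
    simp only [smul_smul, mul_sub, Finset.sum_ite_eq', ite_smul, mul_ite, mul_zero, zero_smul,
      Finset.mem_univ, if_true]
    congr 1
    field_simp
  counit a b := by
    have hN : (N : k) ≠ 0 := NeZero.ne _
    have := sum_char_mul hψ (b - a)
    simp only [fourierIdempotent, map_smul, map_sum, hε, smul_eq_mul, mul_one, this, sub_eq_zero,
      eq_comm (a := b)]
    split_ifs <;> simp [hN]

end Fourier

/-! ### Group algebras and their duals -/

section Group

variable (k : Type u) [Field k] {G : Type v} [Group G]

/-- The powers of an element `g` of a finite group, as group-like elements of `kG` indexed by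
`ℤ/|G|`. -/
def cyclicChar [Finite G] (g : G) : AddChar (ZMod (Nat.card G)) (MonoidAlgebra k G) where
  toFun l := MonoidAlgebra.of k G (g ^ l.val)
  map_zero_eq_one' := by rw [ZMod.val_zero, pow_zero, map_one]
  map_add_eq_mul' a b := by
    rw [← map_mul, ← pow_add, ZMod.val_add, pow_mod_natCard]

lemma cyclicChar_one [Finite G] (g : G) : cyclicChar k g 1 = MonoidAlgebra.of k G g := by
  change MonoidAlgebra.of k G (g ^ (1 : ZMod (Nat.card G)).val) = _
  rw [ZMod.val_one_eq_one_mod, pow_mod_natCard, pow_one]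

/-- The group algebra has a generating magic corepresentation of size `|G|²`, one circulant block
for each element of `G`. -/
lemma exists_isMagicCorep_monoidAlgebra [IsAlgClosed k] [CharZero k] [Fintype G] [DecidableEq G] :
    ∃ x : G × ZMod (Nat.card G) → G × ZMod (Nat.card G) → MonoidAlgebra k G,
      IsMagicCorep k x ∧ Algebra.adjoin k (Set.range fun p : _ × _ => x p.1 p.2) = ⊤ := by
  obtain ⟨ζ, hζ⟩ := HasEnoughRootsOfUnity.exists_primitiveRoot k (Nat.card G)
  have hψ := AddChar.zmodChar_primitive_of_primitive_root _ hζ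
  set ψ := AddChar.zmodChar (Nat.card G) hζ.pow_eq_one
  refine ⟨_, IsMagicCorep.blockDiagonal fun g =>
    isMagicCorep_fourierIdempotent hψ (cyclicChar k g) (fun l => ?_) fun l => ?_, ?_⟩
  · simp [cyclicChar]
  · simp [cyclicChar]
  · refine top_le_iff.1 fun z _ => ?_
    induction z using MonoidAlgebra.induction_on with
    | of g =>
      rw [← cyclicChar_one, ← sum_char_smul_fourierIdempotent hψ (cyclicChar k g) 1]
      refine sum_mem fun a _ => Subalgebra.smul_mem _ (Algebra.subset_adjoin ?_) _
      exact ⟨((g, 0), (g, a)), by simp⟩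
    | add a b ha hb => exact add_mem (ha trivial) (hb trivial)
    | smul r a ha => exact Subalgebra.smul_mem _ (ha trivial) r

/-- The coordinate form at `g` on the group algebra. -/
def coordForm (g : G) : HopfDual k (MonoidAlgebra k G) :=
  (HopfDual.toDual k _).symm (Finsupp.lapply g ∘ₗ (MonoidAlgebra.coeffLinearEquiv k).toLinearMap)

variable {k}

lemma coordForm_apply (g : G) (z : MonoidAlgebra k G) : coordForm k g z = z.coeff g := by
  simp [coordForm]

lemma coordForm_of [DecidableEq G] (g h : G) :
    coordForm k g (MonoidAlgebra.of k G h) = if h = g then 1 else 0 := by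
  simp [coordForm_apply, Finsupp.single_apply]

lemma hopfDual_ext {f f' : HopfDual k (MonoidAlgebra k G)}
    (h : ∀ g, f (MonoidAlgebra.of k G g) = f' (MonoidAlgebra.of k G g)) : f = f' := by
  refine HopfDual.ext' fun z => ?_
  induction z using MonoidAlgebra.induction_on with
  | of g => exact h g
  | add a b ha hb => simp only [map_add, ha, hb]
  | smul r a ha => simp only [map_smul, ha]

lemma hopfDual_mul_of (f f' : HopfDual k (MonoidAlgebra k G)) (g : G) :
    (f * f') (MonoidAlgebra.of k G g) =
      f (MonoidAlgebra.of k G g) * f' (MonoidAlgebra.of k G g) := by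
  rw [HopfDual.mul_apply f f' (ι := Unit)
    ⟨{()}, fun _ => MonoidAlgebra.of k G g, fun _ => MonoidAlgebra.of k G g, by simp⟩]
  simp

variable [Fintype G]

lemma hopfDual_tensor_ext
    {s t : HopfDual k (MonoidAlgebra k G) ⊗[k] HopfDual k (MonoidAlgebra k G)}
    (h : ∀ g g', HopfDual.pairing k _ s (MonoidAlgebra.of k G g ⊗ₜ MonoidAlgebra.of k G g') =
      HopfDual.pairing k _ t (MonoidAlgebra.of k G g ⊗ₜ MonoidAlgebra.of k G g')) : s = t := by
  refine HopfDual.tensor_ext fun x y => ?_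
  induction x using MonoidAlgebra.induction_on with
  | of g =>
    induction y using MonoidAlgebra.induction_on with
    | of g' => exact h g g'
    | add a b ha hb => simp only [tmul_add, map_add, ha, hb]
    | smul r a ha => simp only [tmul_smul, map_smul, ha]
  | add a b ha hb => simp only [add_tmul, map_add, ha, hb]
  | smul r a ha => simp only [← smul_tmul', map_smul, ha]

variable [DecidableEq G]

/-- The permutation corepresentation of the function algebra of `G`, given by the regular action
of `G` on itself. -/
lemma isMagicCorep_coordForm : IsMagicCorep k fun g h : G => coordForm k (g⁻¹ * h) where
  row_mul i j l := hopfDual_ext fun g => by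
    rw [hopfDual_mul_of, coordForm_of, coordForm_of]
    by_cases h : j = l
    · simp [-MonoidAlgebra.of_apply, h, coordForm_of]
    · by_cases h' : g = i⁻¹ * j <;> simp [h, h']
  col_mul i j l := hopfDual_ext fun g => by
    rw [hopfDual_mul_of, coordForm_of, coordForm_of]
    by_cases h : i = l
    · simp [-MonoidAlgebra.of_apply, h, coordForm_of]
    · by_cases h' : g = i⁻¹ * j <;> simp [h, h']
  row_sum i := hopfDual_ext fun g => by
    simp only [map_sum, LinearMap.sum_apply, coordForm_of, eq_inv_mul_iff_mul_eq]
    simp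
  col_sum i := hopfDual_ext fun g => by
    simp only [map_sum, LinearMap.sum_apply, coordForm_of, eq_inv_mul_iff_mul_eq,
      ← eq_mul_inv_iff_mul_eq]
    simp
  comul i j := hopfDual_tensor_ext fun g g' => by
    rw [HopfDual.pairing_comul, ← map_mul, coordForm_of]
    simp only [map_sum, LinearMap.sum_apply, HopfDual.pairing_tmul, coordForm_of,
      eq_inv_mul_iff_mul_eq]
    rw [Finset.sum_eq_single (i * g)] <;> simp +contextual [mul_assoc, eq_comm]
  counit i j := by
    rw [HopfDual.counit_apply, ← map_one (MonoidAlgebra.of k G), coordForm_of]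
    simp [eq_inv_mul_iff_mul_eq]

lemma adjoin_coordForm :
    Algebra.adjoin k (Set.range fun p : G × G => coordForm k (p.1⁻¹ * p.2)) = ⊤ := by
  rw [eq_top_iff]
  rintro f -
  have : f = ∑ g, f (MonoidAlgebra.of k G g) • coordForm k g := hopfDual_ext fun g => by
    simp [-MonoidAlgebra.of_apply, coordForm_of]
  rw [this]
  refine Subalgebra.sum_mem _ fun g _ => Subalgebra.smul_mem _ (Algebra.subset_adjoin ?_) _
  exact ⟨(1, g), by simp⟩

end Group

end QuantumPermutation

end

theorem corollary2p4 (k : Type*) [Field k] [IsAlgClosed k] [CharZero k] :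
    (∀ (H : Type*) [Ring H] [HopfAlgebra k H] [FiniteDimensional k H]
      (hH : QuantumPermutation.IsQuantumPermutationAlgebra k H),
      QuantumPermutation.IsQuantumPermutationAlgebra k (QuantumPermutation.HopfDual k H) →
        QuantumPermutation.IsQuantumPermutationAlgebra k
          (QuantumPermutation.DrinfeldDouble k H hH.antipode_bijective) ∧
        QuantumPermutation.degree k
            (QuantumPermutation.DrinfeldDouble k H hH.antipode_bijective) ≤
          QuantumPermutation.degree k H +
            QuantumPermutation.degree k (QuantumPermutation.HopfDual k H)) ∧
    (∀ (G : Type*) [Group G] [Finite G],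
      QuantumPermutation.IsQuantumPermutationAlgebra k
        (QuantumPermutation.DrinfeldDouble k (MonoidAlgebra k G)
          (QuantumPermutation.antipode_bijective_monoidAlgebra G)) ∧
      QuantumPermutation.degree k
          (QuantumPermutation.DrinfeldDouble k (MonoidAlgebra k G)
            (QuantumPermutation.antipode_bijective_monoidAlgebra G)) ≤
        Nat.card G * (1 + Nat.card G)) := by
  open QuantumPermutation in
  refine ⟨fun H _ _ _ hH hH' => ?_, fun G _ _ => ?_⟩
  · obtain ⟨hn, hq⟩ := hH.degree_spec
    obtain ⟨x, hx, hxa⟩ := hq.exists_corep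
    obtain ⟨y, hy, hya⟩ := hH'.degree_spec.2.exists_corep
    have := isQuotientOfMagic_drinfeldDouble hH.antipode_bijective hx hy hxa hya
    rw [Fintype.card_fin, Fintype.card_fin] at this
    exact this.isQuantumPermutationAlgebra_and_degree_le (Nat.le_add_right_of_le hn)
  · classical
    have := Fintype.ofFinite G
    obtain ⟨x, hx, hxa⟩ := exists_isMagicCorep_monoidAlgebra k (G := G)
    have := isQuotientOfMagic_drinfeldDouble (antipode_bijective_monoidAlgebra G) hx
      isMagicCorep_coordForm hxa adjoin_coordForm
    rw [Fintype.card_prod, ZMod.card, ← Nat.card_eq_fintype_card, add_comm, ← mul_one_add] at this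
    exact this.isQuantumPermutationAlgebra_and_degree_le
      (Nat.mul_pos Nat.card_pos (Nat.add_pos_left one_pos _))
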